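/- Let $E$ be a complex Banach lattice, i.e. the complexification $E = E_{\mathbb R} + iE_{\mathbb R}$ of a real Banach lattice $E_{\mathbb R}$, with modulus $|a+ib| = \sup_{\varphi\in\mathbb R}\big((\cos\varphi)\,a + (\sin\varphi)\,b\big)$ and norm $\|z\| = \|\,|z|\,\|$, and let $T$ be a positive bounded linear operator on $E$. Suppose that $E$ has a pre-dual Banach lattice, i.e. that there is a complex Banach lattice $F$ such that $F' = E$ as Banach lattices (isometrically and with the same order), and that $T$ has a pre-adjoint, i.e. there is a bounded linear operator $S$ on $F$ with $S' = T$. Let $r > 0$, $\theta \in \mathbb{R}$ and let $x \in \ker(r-T)$ with $x > 0$ (that is, $x \ge 0$ and $x \ne 0$). Let $E_x = \{z \in E : |z| \le c\,x \text{ for some } c \ge 0\}$ be the principal ideal generated by $x$. Then, for all $n \in \mathbb{Z}$, $$\dim\big[E_x \cap \ker(re^{i\theta}-T)\big] \le \dim\big[E_x \cap \ker(re^{in\theta}-T)\big],$$ where the dimension of a complex vector space is an element of $\mathbb{N}_0\cup\{\infty\}$ (different infinite cardinalities are not distinguished). In particular, if $re^{i\theta}$ is an eigenvalue of $T$ with an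 eigenvector $0 \ne z \in E_x$, then for each $n \in \mathbb{Z}$ the number $re^{in\theta}$ is also an eigenvalue of $T$ with an eigenvector in $E_x$. -/

import Mathlib

open scoped ComplexOrder

/-- The complexification `X + iX` of a real vector space `X`. -/
@[ext]
structure Complexification (X : Type*) where
  re : X
  im : X

namespace Complexification

section Algebra

variable {X : Type*} [AddCommGroup X]

instance : Zero (Complexification X) := ⟨⟨0, 0⟩⟩
instance : Add (Complexification X) := ⟨fun z w => ⟨z.re + w.re, z.im + w.im⟩⟩
instance : Neg (Complexification X) := ⟨fun z => ⟨-z.re, -z.im⟩⟩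
instance : Sub (Complexification X) := ⟨fun z w => ⟨z.re - w.re, z.im - w.im⟩⟩

@[simp] theorem zero_re : (0 : Complexification X).re = 0 := rfl
@[simp] theorem zero_im : (0 : Complexification X).im = 0 := rfl
@[simp] theorem add_re (z w : Complexification X) : (z + w).re = z.re + w.re := rfl
@[simp] theorem add_im (z w : Complexification X) : (z + w).im = z.im + w.im := rfl
@[simp] theorem neg_re (z : Complexification X) : (-z).re = -z.re := rfl
@[simp] theorem neg_im (z : Complexification X) : (-z).im = -z.im := rfl
@[simp] theorem sub_re (z w : Complexification X) : (z - w).re = z.re - w.re := rfl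
@[simp] theorem sub_im (z w : Complexification X) : (z - w).im = z.im - w.im := rfl

instance : AddCommGroup (Complexification X) where
  add_assoc z w v := by ext <;> simp [add_assoc]
  zero_add z := by ext <;> simp
  add_zero z := by ext <;> simp
  nsmul := nsmulRec
  zsmul := zsmulRec
  neg_add_cancel z := by ext <;> simp
  sub_eq_add_neg z w := by ext <;> simp [sub_eq_add_neg]
  add_comm z w := by ext <;> simp [add_comm]

variable [Module ℝ X]

/-- `(s + it)(a + ib) = (sa - tb) + i(sb + ta)`. -/
instance : SMul ℂ (Complexification X) :=
  ⟨fun c z => ⟨c.re • z.re - c.im • z.im, c.re • z.im + c.im • z.re⟩⟩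

@[simp] theorem smul_re (c : ℂ) (z : Complexification X) :
    (c • z).re = c.re • z.re - c.im • z.im := rfl
@[simp] theorem smul_im (c : ℂ) (z : Complexification X) :
    (c • z).im = c.re • z.im + c.im • z.re := rfl

instance : Module ℂ (Complexification X) where
  one_smul z := by ext <;> simp
  mul_smul c d z := by
    ext <;> simp only [smul_re, smul_im, Complex.mul_re, Complex.mul_im] <;> module
  smul_zero c := by ext <;> simp
  smul_add c z w := by ext <;> simp only [smul_re, smul_im, add_re, add_im] <;> module
  add_smul c d z := by
    ext <;> simp only [smul_re, smul_im, add_re, add_im, Complex.add_re, Complex.add_im] <;> module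
  zero_smul z := by ext <;> simp

end Algebra

/-- `z ≤ w` means that `w - z` is a positive element of the real part `X` of `X + iX`; in
particular `0 ≤ z` says that `z` is real and positive. -/
instance {X : Type*} [PartialOrder X] : PartialOrder (Complexification X) where
  le z w := z.re ≤ w.re ∧ z.im = w.im
  le_refl z := ⟨le_rfl, rfl⟩
  le_trans z w v h₁ h₂ := ⟨h₁.1.trans h₂.1, h₁.2.trans h₂.2⟩
  le_antisymm z w h₁ h₂ := Complexification.ext (le_antisymm h₁.1 h₂.1) h₁.2

theorem le_def {X : Type*} [PartialOrder X] {z w : Complexification X} :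
    z ≤ w ↔ z.re ≤ w.re ∧ z.im = w.im := Iff.rfl

section Modulus

theorem smul_le_abs_smul_abs {X : Type*} [NormedAddCommGroup X] [Lattice X]
    [NormedSpace ℝ X] [IsOrderedModule ℝ X] (c : ℝ) (a : X) : c • a ≤ |c| • |a| := by
  rcases le_total 0 c with h | h
  · rw [abs_of_nonneg h]
    exact smul_le_smul_of_nonneg_left (le_abs_self a) h
  · rw [abs_of_nonpos h, ← neg_smul_neg c a]
    exact smul_le_smul_of_nonneg_left (neg_le_abs a) (neg_nonneg.2 h)

variable {X : Type*} [NormedAddCommGroup X] [Lattice X] [IsOrderedAddMonoid X] [HasSolidNorm X]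
  [NormedSpace ℝ X] [IsOrderedModule ℝ X]

/-- `Re (e^{-iθ} z) = (cos θ) a + (sin θ) b` for `z = a + ib`. -/
noncomputable def rot (z : Complexification X) (θ : ℝ) : X :=
  Real.cos θ • z.re + Real.sin θ • z.im

theorem rot_le_rot_add (z : Complexification X) (s t : ℝ) :
    rot z s ≤ rot z t + |s - t| • (|z.re| + |z.im|) := by
  have h₁ : (Real.cos s - Real.cos t) • z.re ≤ |s - t| • |z.re| :=
    (smul_le_abs_smul_abs _ _).trans
      (smul_le_smul_of_nonneg_right (Real.abs_cos_sub_cos_le s t) (abs_nonneg _))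
  have h₂ : (Real.sin s - Real.sin t) • z.im ≤ |s - t| • |z.im| :=
    (smul_le_abs_smul_abs _ _).trans
      (smul_le_smul_of_nonneg_right (Real.abs_sin_sub_sin_le s t) (abs_nonneg _))
  calc rot z s = rot z t + ((Real.cos s - Real.cos t) • z.re
        + (Real.sin s - Real.sin t) • z.im) := by simp only [rot]; module
    _ ≤ rot z t + (|s - t| • |z.re| + |s - t| • |z.im|) := by gcongr
    _ = _ := by rw [smul_add]

theorem exists_grid (θ : ℝ) (N : ℕ) :
    ∃ j ∈ Finset.range (N + 1), ∃ s : ℝ, Real.cos s = Real.cos θ ∧ Real.sin s = Real.sin θ ∧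
      |s - 2 * Real.pi * j / (N + 1)| ≤ 2 * Real.pi / (N + 1) := by
  have hp := Real.two_pi_pos
  have hN : (0 : ℝ) < N + 1 := by positivity
  obtain ⟨h0, h1⟩ := toIcoMod_mem_Ico' hp θ
  set s := toIcoMod hp 0 θ with hs
  have hsθ : s = θ - toIcoDiv hp 0 θ * (2 * Real.pi) := by
    rw [hs, toIcoMod, zsmul_eq_mul]
  have hq0 : 0 ≤ s * (N + 1) / (2 * Real.pi) := by positivity
  have hf1 := Nat.floor_le hq0
  have hf2 := Nat.lt_floor_add_one (s * (N + 1) / (2 * Real.pi))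
  refine ⟨⌊s * (N + 1) / (2 * Real.pi)⌋₊, ?_, s, ?_, ?_, ?_⟩
  · rw [Finset.mem_range, Nat.floor_lt hq0, div_lt_iff₀ hp]
    push_cast
    nlinarith
  · rw [hsθ, Real.cos_sub_int_mul_two_pi]
  · rw [hsθ, Real.sin_sub_int_mul_two_pi]
  · rw [le_div_iff₀ hp] at hf1
    rw [div_lt_iff₀ hp] at hf2
    have e : s - 2 * Real.pi * (⌊s * (N + 1) / (2 * Real.pi)⌋₊ : ℝ) / (N + 1)
        = (s * (N + 1) - ⌊s * (N + 1) / (2 * Real.pi)⌋₊ * (2 * Real.pi)) / (N + 1) := by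
      field_simp
    rw [e, abs_of_nonneg (div_nonneg (by linarith) hN.le)]
    exact div_le_div_of_nonneg_right (by linarith) hN.le

/-- In a Banach lattice the supremum defining the modulus exists. -/
theorem exists_isLUB_rot [CompleteSpace X] (z : Complexification X) :
    ∃ m : X, IsLUB (Set.range (rot z)) m := by
  set u : X := |z.re| + |z.im| with hu
  have hu0 : 0 ≤ u := add_nonneg (abs_nonneg _) (abs_nonneg _)
  let f : ℕ → ℕ → X := fun N j => rot z (2 * Real.pi * j / (N + 1))
  let g : ℕ → X := fun N => (Finset.range (N + 1)).sup' Finset.nonempty_range_add_one (f N)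
  let ε : ℕ → ℝ := fun N => 2 * Real.pi * (1 / ((N : ℝ) + 1))
  have hε : Filter.Tendsto ε Filter.atTop (nhds 0) := by
    simpa [ε] using tendsto_one_div_add_atTop_nhds_zero_nat.const_mul (2 * Real.pi)
  have key : ∀ N θ, rot z θ ≤ g N + ε N • u := by
    intro N θ
    obtain ⟨j, hj, s, hc, hs, hd⟩ := exists_grid θ N
    have e : rot z θ = rot z s := by simp only [rot, hc, hs]
    rw [e]
    refine (rot_le_rot_add z s (2 * Real.pi * j / (N + 1))).trans (add_le_add ?_ ?_)
    · exact Finset.le_sup' (f N) hj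
    · refine smul_le_smul_of_nonneg_right (hd.trans_eq ?_) hu0
      simp only [ε]; ring
  have key' : ∀ M N, g M - g N ≤ ε N • u := fun M N =>
    sub_le_iff_le_add'.2 (Finset.sup'_le _ _ fun j _ => key N _)
  have hε0 : ∀ N, 0 ≤ ε N := fun N => by positivity
  have hcau : CauchySeq g := by
    refine cauchySeq_of_le_tendsto_0 (fun N => ε N * ‖u‖) (fun n m N hn hm => ?_) ?_
    · have mono : ∀ k, N ≤ k → ε k • u ≤ ε N • u := fun k hk =>
        smul_le_smul_of_nonneg_right (by simp only [ε]; gcongr) hu0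
      have h : |g n - g m| ≤ |ε N • u| := by
        rw [abs_of_nonneg (smul_nonneg (hε0 N) hu0)]
        refine abs_le'.2 ⟨(key' n m).trans (mono m hm), ?_⟩
        rw [neg_sub]
        exact (key' m n).trans (mono n hn)
      rw [dist_eq_norm]
      refine (norm_le_norm_of_abs_le_abs h).trans_eq ?_
      rw [norm_smul, Real.norm_of_nonneg (hε0 N)]
    · simpa using hε.mul_const ‖u‖
  obtain ⟨m, hm⟩ := cauchySeq_tendsto_of_complete hcau
  refine ⟨m, ?_, ?_⟩
  · rintro _ ⟨θ, rfl⟩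
    have h : Filter.Tendsto (fun N => g N + ε N • u) Filter.atTop (nhds m) := by
      simpa using hm.add (hε.smul_const u)
    exact ge_of_tendsto' h fun N => key N θ
  · intro b hb
    exact le_of_tendsto' hm fun N => Finset.sup'_le _ _ fun j _ => hb ⟨_, rfl⟩

variable [CompleteSpace X]

/-- The modulus `|z| = sup_θ ((cos θ) a + (sin θ) b)` of `z = a + ib`. -/
noncomputable def modulus (z : Complexification X) : X :=
  Classical.choose (exists_isLUB_rot z)

theorem isLUB_modulus (z : Complexification X) : IsLUB (Set.range (rot z)) (modulus z) :=
  Classical.choose_spec (exists_isLUB_rot z)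

theorem rot_le_modulus (z : Complexification X) (θ : ℝ) : rot z θ ≤ modulus z :=
  (isLUB_modulus z).1 ⟨θ, rfl⟩

theorem modulus_le {z : Complexification X} {b : X} (h : ∀ θ, rot z θ ≤ b) : modulus z ≤ b :=
  (isLUB_modulus z).2 (by rintro _ ⟨θ, rfl⟩; exact h θ)

theorem abs_re_le_modulus (z : Complexification X) : |z.re| ≤ modulus z :=
  abs_le'.2 ⟨by simpa [rot] using rot_le_modulus z 0,
    by simpa [rot] using rot_le_modulus z Real.pi⟩

theorem abs_im_le_modulus (z : Complexification X) : |z.im| ≤ modulus z :=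
  abs_le'.2 ⟨by simpa [rot] using rot_le_modulus z (Real.pi / 2),
    by simpa [rot] using rot_le_modulus z (-(Real.pi / 2))⟩

theorem modulus_nonneg (z : Complexification X) : 0 ≤ modulus z :=
  (abs_nonneg _).trans (abs_re_le_modulus z)

theorem modulus_le_abs_add_abs (z : Complexification X) : modulus z ≤ |z.re| + |z.im| := by
  refine modulus_le fun θ => add_le_add ?_ ?_
  · refine (smul_le_abs_smul_abs _ _).trans ?_
    simpa using smul_le_smul_of_nonneg_right (Real.abs_cos_le_one θ) (abs_nonneg z.re)
  · refine (smul_le_abs_smul_abs _ _).trans ?_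
    simpa using smul_le_smul_of_nonneg_right (Real.abs_sin_le_one θ) (abs_nonneg z.im)

theorem modulus_add_le (z w : Complexification X) : modulus (z + w) ≤ modulus z + modulus w := by
  refine modulus_le fun θ => ?_
  have : rot (z + w) θ = rot z θ + rot w θ := by simp only [rot, add_re, add_im]; module
  rw [this]
  exact add_le_add (rot_le_modulus z θ) (rot_le_modulus w θ)

theorem modulus_smul_le (c : ℂ) (z : Complexification X) :
    modulus (c • z) ≤ ‖c‖ • modulus z := by
  refine modulus_le fun θ => ?_
  have e : rot (c • z) θ = ‖c‖ • rot z (θ - c.arg) := by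
    have h₁ := Complex.norm_mul_cos_arg c
    have h₂ := Complex.norm_mul_sin_arg c
    simp only [rot, smul_re, smul_im, Real.cos_sub, Real.sin_sub]
    rw [← h₁, ← h₂]
    module
  rw [e]
  exact smul_le_smul_of_nonneg_left (rot_le_modulus z _) (norm_nonneg c)

theorem modulus_smul (c : ℂ) (z : Complexification X) : modulus (c • z) = ‖c‖ • modulus z := by
  refine le_antisymm (modulus_smul_le c z) ?_
  rcases eq_or_ne c 0 with rfl | hc
  · simpa using modulus_nonneg _
  · have h := modulus_smul_le c⁻¹ (c • z)
    rw [inv_smul_smul₀ hc] at h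
    have h' := smul_le_smul_of_nonneg_left h (norm_nonneg c)
    rwa [smul_smul, norm_inv, mul_inv_cancel₀ (norm_ne_zero_iff.2 hc), one_smul] at h'

theorem modulus_eq_zero {z : Complexification X} (h : modulus z = 0) : z = 0 := by
  have h₁ := abs_re_le_modulus z
  have h₂ := abs_im_le_modulus z
  rw [h] at h₁ h₂
  have a₁ : |z.re| = 0 := le_antisymm h₁ (abs_nonneg _)
  have a₂ : |z.im| = 0 := le_antisymm h₂ (abs_nonneg _)
  ext
  · exact norm_eq_zero.1 (by rw [← norm_abs_eq_norm, a₁, norm_zero])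
  · exact norm_eq_zero.1 (by rw [← norm_abs_eq_norm, a₂, norm_zero])

/-- The norm of a complex Banach lattice: `‖z‖ = ‖|z|‖`. -/
noncomputable instance : Norm (Complexification X) := ⟨fun z => ‖modulus z‖⟩

theorem norm_def (z : Complexification X) : ‖z‖ = ‖modulus z‖ := rfl

theorem normedSpaceCore : NormedSpace.Core ℂ (Complexification X) where
  norm_nonneg z := norm_nonneg (modulus z)
  norm_smul c z := by
    rw [norm_def, modulus_smul, norm_smul, norm_norm, ← norm_def]
  norm_triangle z w := by
    refine le_trans ?_ (norm_add_le (modulus z) (modulus w))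
    refine norm_le_norm_of_abs_le_abs ?_
    rw [abs_of_nonneg (modulus_nonneg _),
      abs_of_nonneg (add_nonneg (modulus_nonneg _) (modulus_nonneg _))]
    exact modulus_add_le z w
  norm_eq_zero_iff z := by
    constructor
    · intro h
      exact modulus_eq_zero (norm_eq_zero.1 h)
    · rintro rfl
      have h := modulus_smul (0 : ℂ) (0 : Complexification X)
      rw [norm_def]
      simpa using h

noncomputable instance : NormedAddCommGroup (Complexification X) :=
  NormedAddCommGroup.ofCore normedSpaceCore

noncomputable instance : NormedSpace ℂ (Complexification X) :=
  NormedSpace.ofCore normedSpaceCore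

/-- A complex Banach lattice is a complex Banach space. -/
instance : CompleteSpace (Complexification X) := by
  have hre : ∀ z : Complexification X, ‖z.re‖ ≤ ‖z‖ := fun z =>
    norm_le_norm_of_abs_le_abs (by
      rw [abs_of_nonneg (modulus_nonneg z)]; exact abs_re_le_modulus z)
  have him : ∀ z : Complexification X, ‖z.im‖ ≤ ‖z‖ := fun z =>
    norm_le_norm_of_abs_le_abs (by
      rw [abs_of_nonneg (modulus_nonneg z)]; exact abs_im_le_modulus z)
  have hle : ∀ z : Complexification X, ‖z‖ ≤ ‖z.re‖ + ‖z.im‖ := fun z => by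
    have h : ‖modulus z‖ ≤ ‖|z.re| + |z.im|‖ := norm_le_norm_of_abs_le_abs (by
      rw [abs_of_nonneg (modulus_nonneg z),
        abs_of_nonneg (add_nonneg (abs_nonneg _) (abs_nonneg _))]
      exact modulus_le_abs_add_abs z)
    refine h.trans ((norm_add_le _ _).trans_eq ?_)
    rw [norm_abs_eq_norm, norm_abs_eq_norm]
  refine Metric.complete_of_cauchySeq_tendsto fun s hs => ?_
  have h₁ : CauchySeq fun n => (s n).re := by
    rw [Metric.cauchySeq_iff] at hs ⊢
    intro ε hε
    obtain ⟨N, hN⟩ := hs ε hε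
    refine ⟨N, fun m hm n hn => ?_⟩
    have h := hN m hm n hn
    rw [dist_eq_norm] at h ⊢
    exact (hre (s m - s n)).trans_lt h
  have h₂ : CauchySeq fun n => (s n).im := by
    rw [Metric.cauchySeq_iff] at hs ⊢
    intro ε hε
    obtain ⟨N, hN⟩ := hs ε hε
    refine ⟨N, fun m hm n hn => ?_⟩
    have h := hN m hm n hn
    rw [dist_eq_norm] at h ⊢
    exact (him (s m - s n)).trans_lt h
  obtain ⟨a, ha⟩ := cauchySeq_tendsto_of_complete h₁
  obtain ⟨b, hb⟩ := cauchySeq_tendsto_of_complete h₂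
  refine ⟨⟨a, b⟩, tendsto_iff_norm_sub_tendsto_zero.2 ?_⟩
  refine squeeze_zero (fun n => norm_nonneg _) (fun n => hle _) ?_
  simpa using (tendsto_iff_norm_sub_tendsto_zero.1 ha).add
    (tendsto_iff_norm_sub_tendsto_zero.1 hb)

/-- The principal ideal `E_x = {z : |z| ≤ c|x| for some c ≥ 0}` of a complex Banach lattice. -/
noncomputable def principalIdeal (x : Complexification X) :
    Submodule ℂ (Complexification X) where
  carrier := {z | ∃ c : ℝ, 0 ≤ c ∧ modulus z ≤ c • modulus x}
  add_mem' := by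
    rintro z w ⟨c, hc, hz⟩ ⟨d, hd, hw⟩
    refine ⟨c + d, add_nonneg hc hd, (modulus_add_le z w).trans ?_⟩
    rw [add_smul]
    exact add_le_add hz hw
  zero_mem' := ⟨0, le_rfl, by
    have h := modulus_smul (0 : ℂ) (0 : Complexification X)
    simp at h
    simp [h]⟩
  smul_mem' := by
    rintro a z ⟨c, hc, hz⟩
    refine ⟨‖a‖ * c, mul_nonneg (norm_nonneg a) hc, ?_⟩
    rw [modulus_smul, mul_smul]
    exact smul_le_smul_of_nonneg_left hz (norm_nonneg a)

/-- A bounded operator on a complex Banach lattice is positive if it maps positive elements to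
positive elements. -/
def IsPositiveOperator (T : Complexification X →L[ℂ] Complexification X) : Prop :=
  ∀ z, 0 ≤ z → 0 ≤ T z

end Modulus

end Complexification

open Complexification in
/-- The complex Banach lattice `F = Y + iY` is a pre-dual of the complex Banach lattice
`E = X + iX`: an identification of `E` with the dual Banach lattice `F'`, that is, an isometric
`ℂ`-linear isomorphism which is an order isomorphism when the dual carries its usual order
(a functional is positive if it is nonnegative on all positive elements). -/
structure PredualBanachLattice
    (X : Type*) [NormedAddCommGroup X] [Lattice X] [IsOrderedAddMonoid X] [HasSolidNorm X]
    [NormedSpace ℝ X] [IsOrderedModule ℝ X] [CompleteSpace X]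
    (Y : Type*) [NormedAddCommGroup Y] [Lattice Y] [IsOrderedAddMonoid Y] [HasSolidNorm Y]
    [NormedSpace ℝ Y] [IsOrderedModule ℝ Y] [CompleteSpace Y] where
  toDual : Complexification X ≃ₗᵢ[ℂ] StrongDual ℂ (Complexification Y)
  nonneg_iff : ∀ z : Complexification X, 0 ≤ z ↔ ∀ y : Complexification Y, 0 ≤ y → 0 ≤ toDual z y

namespace PredualBanachLattice

variable {X : Type*} [NormedAddCommGroup X] [Lattice X] [IsOrderedAddMonoid X] [HasSolidNorm X]
  [NormedSpace ℝ X] [IsOrderedModule ℝ X] [CompleteSpace X]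
  {Y : Type*} [NormedAddCommGroup Y] [Lattice Y] [IsOrderedAddMonoid Y] [HasSolidNorm Y]
  [NormedSpace ℝ Y] [IsOrderedModule ℝ Y] [CompleteSpace Y]

/-- `S` is a pre-adjoint of `T`: under the identification `E = F'` one has `T = S'`, i.e.
`⟨T z, y⟩ = ⟨z, S y⟩` for all `z ∈ E`, `y ∈ F`. -/
def IsPreadjoint (J : PredualBanachLattice X Y)
    (S : Complexification Y →L[ℂ] Complexification Y)
    (T : Complexification X →L[ℂ] Complexification X) : Prop :=
  ∀ z y, J.toDual (T z) y = J.toDual z (S y)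

end PredualBanachLattice

/-! By Kakutani's theorem the ideal `E_x` is a space `C(K)` in which `x` is the constant 1, and
`r⁻¹T` acts there as a positive unital operator `A` (`exists_markov_model`). The task is to turn
eigenvectors of `A` for a unimodular `c` into eigenvectors for `c ^ n`. If `A` were multiplicative,
powers of `z` and of its conjugate would do. In general, Cauchy-Schwarz gives `|z|² ≤ A|z|²` for an
eigenvector `z`, and at a point `k` with equality `z` lies in the multiplicative domain of `f ↦ (A
f)(k)`.

The pre-dual provides enough points of equality. Order intervals are weak-* compact and the
pre-adjoint makes `A` weak-* continuous, so the powers `A ^ m` converge along an idempotent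
ultrafilter to a positive projection `P` commuting with `A` (`exists_isPeripheralProjection`). Since
`c ^ m → 1` along this ultrafilter, `P` fixes `z`. Let `M` be the common zero set of the positive
functions in `ker P` (`carrierSet`). Equality holds on `M`, and `P` annihilates whatever vanishes on
`M` (`complexify_eq_zero_of_carrierSet`). Hence `P (z ^ a * star z ^ b)` equals `z ^ a * star z ^ b`
on `M` and satisfies the eigenvector equation for `c ^ (a - b)`.

For the dimensions, restriction to `M` is injective on the eigenspace, so independent eigenvectors
can be recombined to be dual to points of `M`. Monomials with `a, b ≥ 1` preserve the values 0 and
1, so duality, and with it independence, survives (`exists_linearIndependent_zpow`). -/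

namespace MarkovOperator

/-! ### Cauchy-Schwarz and multiplicative domains of positive functionals -/

section Functional

variable {K : Type*} [TopologicalSpace K]

/-- The pointwise real part of a complex continuous function. -/
noncomputable def rePart (f : C(K, ℂ)) : C(K, ℝ) := ⟨fun k => (f k).re, by fun_prop⟩

/-- The pointwise imaginary part of a complex continuous function. -/
noncomputable def imPart (f : C(K, ℂ)) : C(K, ℝ) := ⟨fun k => (f k).im, by fun_prop⟩

/-- The pointwise squared absolute value of a complex continuous function. -/
noncomputable def sqAbs (f : C(K, ℂ)) : C(K, ℝ) := ⟨fun k => Complex.normSq (f k), by fun_prop⟩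

@[simp] theorem rePart_apply (f : C(K, ℂ)) (k : K) : rePart f k = (f k).re := rfl
@[simp] theorem imPart_apply (f : C(K, ℂ)) (k : K) : imPart f k = (f k).im := rfl
@[simp] theorem sqAbs_apply (f : C(K, ℂ)) (k : K) : sqAbs f k = Complex.normSq (f k) := rfl

theorem rePart_add (f g : C(K, ℂ)) : rePart (f + g) = rePart f + rePart g := by ext; simp
theorem imPart_add (f g : C(K, ℂ)) : imPart (f + g) = imPart f + imPart g := by ext; simp
theorem rePart_smul (c : ℂ) (f : C(K, ℂ)) :
    rePart (c • f) = c.re • rePart f - c.im • imPart f := by ext; simp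
theorem imPart_smul (c : ℂ) (f : C(K, ℂ)) :
    imPart (c • f) = c.re • imPart f + c.im • rePart f := by ext; simp

theorem sqAbs_nonneg (f : C(K, ℂ)) : 0 ≤ sqAbs f := fun k => Complex.normSq_nonneg (f k)

/-- The complex linear extension of a real functional on `C(K, ℝ)` to `C(K, ℂ)`. -/
noncomputable def complexifyFunctional (φ : C(K, ℝ) →ₗ[ℝ] ℝ) : C(K, ℂ) →ₗ[ℂ] ℂ where
  toFun f := ⟨φ (rePart f), φ (imPart f)⟩
  map_add' f g := by simp [rePart_add, imPart_add, Complex.ext_iff]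
  map_smul' c f := by simp [rePart_smul, imPart_smul, Complex.ext_iff]

theorem complexifyFunctional_one {φ : C(K, ℝ) →ₗ[ℝ] ℝ} (h1 : φ 1 = 1) :
    complexifyFunctional φ 1 = 1 := by
  have e1 : rePart (1 : C(K, ℂ)) = 1 := by ext; simp
  have e2 : imPart (1 : C(K, ℂ)) = 0 := by ext; simp
  simp [complexifyFunctional, e1, e2, h1, Complex.ext_iff]

theorem complexifyFunctional_star (φ : C(K, ℝ) →ₗ[ℝ] ℝ) (f : C(K, ℂ)) :
    complexifyFunctional φ (star f) = star (complexifyFunctional φ f) := by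
  have e1 : rePart (star f) = rePart f := by ext; simp
  have e2 : imPart (star f) = -imPart f := by ext; simp
  simp [complexifyFunctional, e1, e2, Complex.ext_iff]

theorem sqAbs_sub_const (f : C(K, ℂ)) (c : ℂ) :
    sqAbs (f - c • 1) =
      sqAbs f - (2 * c.re) • rePart f - (2 * c.im) • imPart f + Complex.normSq c • 1 := by
  ext k
  simp [Complex.normSq_apply]
  ring

/-- The variance identity: it yields Cauchy-Schwarz, and in the case of equality it says that `f`
has zero variance. -/
theorem functional_sqAbs_sub {φ : C(K, ℝ) →ₗ[ℝ] ℝ} (h1 : φ 1 = 1) (f : C(K, ℂ)) :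
    φ (sqAbs (f - complexifyFunctional φ f • 1)) =
      φ (sqAbs f) - Complex.normSq (complexifyFunctional φ f) := by
  rw [sqAbs_sub_const]
  simp [h1, complexifyFunctional, Complex.normSq_apply]
  ring

/-- The Cauchy-Schwarz inequality `|φ f|² ≤ φ |f|²` for a normalised positive functional. -/
theorem normSq_complexifyFunctional_le {φ : C(K, ℝ) →ₗ[ℝ] ℝ} (h0 : ∀ f, 0 ≤ f → 0 ≤ φ f)
    (h1 : φ 1 = 1) (f : C(K, ℂ)) :
    Complex.normSq (complexifyFunctional φ f) ≤ φ (sqAbs f) := by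
  have := h0 _ (sqAbs_nonneg (f - complexifyFunctional φ f • 1))
  rw [functional_sqAbs_sub h1] at this
  linarith

/-- If equality holds in the Cauchy-Schwarz inequality for `z`, then `z` lies in the
multiplicative domain of the functional. -/
theorem complexifyFunctional_mul [CompactSpace K] {φ : C(K, ℝ) →ₗ[ℝ] ℝ}
    (h0 : ∀ f, 0 ≤ f → 0 ≤ φ f) (h1 : φ 1 = 1) {z : C(K, ℂ)}
    (hz : φ (sqAbs z) = Complex.normSq (complexifyFunctional φ z)) (g : C(K, ℂ)) :
    complexifyFunctional φ (z * g) = complexifyFunctional φ z * complexifyFunctional φ g := by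
  set c := complexifyFunctional φ z with hc
  have hw : φ (sqAbs (z - c • 1)) = 0 := by rw [hc, functional_sqAbs_sub h1, hz, sub_self]
  -- `z - c` has zero second moment, hence so does its product with the bounded function `g`;
  -- Cauchy-Schwarz then kills the functional on the product.
  have hle : sqAbs ((z - c • 1) * g) ≤ (‖g‖ ^ 2) • sqAbs (z - c • 1) := by
    intro k
    have : Complex.normSq (g k) ≤ ‖g‖ ^ 2 := by
      rw [Complex.normSq_eq_norm_sq]
      gcongr
      exact g.norm_coe_le_norm k
    have h2 := mul_le_mul_of_nonneg_right this (Complex.normSq_nonneg ((z - c • 1) k))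
    change Complex.normSq ((z - c • 1) k * g k) ≤ ‖g‖ ^ 2 * Complex.normSq ((z - c • 1) k)
    rwa [map_mul, mul_comm]
  have h2 : φ (sqAbs ((z - c • 1) * g)) ≤ 0 := by
    have := h0 _ (sub_nonneg.2 hle)
    rw [map_sub, map_smul, hw, smul_zero] at this
    linarith
  have h3 : complexifyFunctional φ ((z - c • 1) * g) = 0 := by
    refine Complex.normSq_eq_zero.1 (le_antisymm ?_ (Complex.normSq_nonneg _))
    exact (normSq_complexifyFunctional_le h0 h1 _).trans h2
  have e : z * g = (z - c • 1) * g + c • g := by ext; simp; ring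
  rw [e, map_add, h3, map_smul, zero_add, smul_eq_mul]

theorem complexifyFunctional_star_mul [CompactSpace K] {φ : C(K, ℝ) →ₗ[ℝ] ℝ}
    (h0 : ∀ f, 0 ≤ f → 0 ≤ φ f) (h1 : φ 1 = 1) {z : C(K, ℂ)}
    (hz : φ (sqAbs z) = Complex.normSq (complexifyFunctional φ z)) (g : C(K, ℂ)) :
    complexifyFunctional φ (star z * g) =
      star (complexifyFunctional φ z) * complexifyFunctional φ g := by
  have e : star z * g = star (z * star g) := by ext; simp
  rw [e, complexifyFunctional_star, complexifyFunctional_mul h0 h1 hz, complexifyFunctional_star]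
  simp

end Functional

/-! ### Markov operators and the carrier of a projection -/

section Operator

variable {K : Type*} [TopologicalSpace K]

/-- Positive unital operators on `C(K, ℝ)`. -/
structure IsMarkov (T : C(K, ℝ) →ₗ[ℝ] C(K, ℝ)) : Prop where
  nonneg : ∀ f, 0 ≤ f → 0 ≤ T f
  map_one : T 1 = 1

/-- The functional `f ↦ (T f)(k)`. -/
def evalAt (T : C(K, ℝ) →ₗ[ℝ] C(K, ℝ)) (k : K) : C(K, ℝ) →ₗ[ℝ] ℝ where
  toFun f := T f k
  map_add' f g := by simp
  map_smul' c f := by simp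

/-- The complex linear extension of an operator on `C(K, ℝ)` to `C(K, ℂ)`. -/
noncomputable def complexify (T : C(K, ℝ) →ₗ[ℝ] C(K, ℝ)) : C(K, ℂ) →ₗ[ℂ] C(K, ℂ) where
  toFun f := ⟨fun k => T (rePart f) k + T (imPart f) k * Complex.I, by fun_prop⟩
  map_add' f g := by ext; simp [rePart_add, imPart_add]; ring
  map_smul' c f := by
    ext k
    simp [rePart_smul, imPart_smul, Complex.ext_iff]

theorem complexify_apply (T : C(K, ℝ) →ₗ[ℝ] C(K, ℝ)) (f : C(K, ℂ)) (k : K) :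
    complexify T f k = complexifyFunctional (evalAt T k) f := by
  simp [complexify, complexifyFunctional, evalAt, Complex.ext_iff]

@[simp] theorem rePart_complexify (T : C(K, ℝ) →ₗ[ℝ] C(K, ℝ)) (f : C(K, ℂ)) :
    rePart (complexify T f) = T (rePart f) := by
  ext; simp [complexify]

@[simp] theorem imPart_complexify (T : C(K, ℝ) →ₗ[ℝ] C(K, ℝ)) (f : C(K, ℂ)) :
    imPart (complexify T f) = T (imPart f) := by
  ext; simp [complexify]

theorem ext_parts {f g : C(K, ℂ)} (h1 : rePart f = rePart g) (h2 : imPart f = imPart g) :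
    f = g := by
  ext k
  exact Complex.ext (congr($h1 k)) (congr($h2 k))

theorem complexify_comm {T P : C(K, ℝ) →ₗ[ℝ] C(K, ℝ)} (h : ∀ f, T (P f) = P (T f))
    (f : C(K, ℂ)) : complexify T (complexify P f) = complexify P (complexify T f) :=
  ext_parts (by simp [h]) (by simp [h])

namespace IsMarkov

variable {T P : C(K, ℝ) →ₗ[ℝ] C(K, ℝ)}

theorem mono (hT : IsMarkov T) {f g : C(K, ℝ)} (h : f ≤ g) : T f ≤ T g := by
  have := hT.nonneg _ (sub_nonneg.2 h)
  rwa [map_sub, sub_nonneg] at this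

theorem evalAt_nonneg (hT : IsMarkov T) (k : K) (f : C(K, ℝ)) (hf : 0 ≤ f) :
    0 ≤ evalAt T k f := hT.nonneg f hf k

theorem evalAt_one (hT : IsMarkov T) (k : K) : evalAt T k 1 = 1 := by
  simp [evalAt, hT.map_one]

theorem sqAbs_complexify_le (hT : IsMarkov T) (f : C(K, ℂ)) :
    sqAbs (complexify T f) ≤ T (sqAbs f) := fun k => by
  change Complex.normSq (complexify T f k) ≤ evalAt T k (sqAbs f)
  rw [complexify_apply]
  exact normSq_complexifyFunctional_le (hT.evalAt_nonneg k) (hT.evalAt_one k) f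

theorem complexify_mul [CompactSpace K] (hT : IsMarkov T) {z : C(K, ℂ)} {k : K}
    (hz : T (sqAbs z) k = Complex.normSq (complexify T z k)) (g : C(K, ℂ)) :
    complexify T (z * g) k = complexify T z k * complexify T g k := by
  simp only [complexify_apply] at hz ⊢
  exact complexifyFunctional_mul (hT.evalAt_nonneg k) (hT.evalAt_one k) hz g

theorem complexify_star_mul [CompactSpace K] (hT : IsMarkov T) {z : C(K, ℂ)} {k : K}
    (hz : T (sqAbs z) k = Complex.normSq (complexify T z k)) (g : C(K, ℂ)) :
    complexify T (star z * g) k = star (complexify T z k) * complexify T g k := by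
  simp only [complexify_apply] at hz ⊢
  exact complexifyFunctional_star_mul (hT.evalAt_nonneg k) (hT.evalAt_one k) hz g

theorem complexify_one (hT : IsMarkov T) : complexify T 1 = 1 := by
  ext k
  rw [complexify_apply, complexifyFunctional_one (hT.evalAt_one k)]
  rfl

end IsMarkov

/-- The common zero set of the positive functions annihilated by `P`. -/
def carrierSet (P : C(K, ℝ) →ₗ[ℝ] C(K, ℝ)) : Set K :=
  {k | ∀ f, 0 ≤ f → P f = 0 → f k = 0}

namespace IsMarkov

variable [CompactSpace K] {T P : C(K, ℝ) →ₗ[ℝ] C(K, ℝ)}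

/-- The compact set `{g ≥ ε}` misses the carrier, so finitely many positive functions killed by `P`
have a sum `F` that is positive on it. Then `g ≤ ε + cF` gives `P g ≤ ε`. -/
theorem map_eq_zero_of_carrierSet (hP : IsMarkov P) {g : C(K, ℝ)} (hg : 0 ≤ g)
    (h : ∀ k ∈ carrierSet P, g k = 0) : P g = 0 := by
  refine le_antisymm ?_ (hP.nonneg g hg)
  intro k
  refine le_of_forall_pos_le_add fun ε hε => ?_
  have hC : IsCompact {k | ε ≤ g k} := (isClosed_le continuous_const g.continuous).isCompact
  have hcov : ∀ t ∈ {k | ε ≤ g k}, ∃ f : C(K, ℝ), 0 ≤ f ∧ P f = 0 ∧ 0 < f t := by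
    intro t ht
    by_contra! hcon
    have : t ∈ carrierSet P := fun f hf hPf => le_antisymm (hcon f hf hPf) (hf t)
    have := h t this
    simp only [Set.mem_ofPred_eq, this] at ht
    exact absurd ht (not_le.2 hε)
  obtain ⟨F, hF0, hPF, hF⟩ : ∃ F : C(K, ℝ), 0 ≤ F ∧ P F = 0 ∧ ∀ t ∈ {k | ε ≤ g k}, 0 < F t := by
    refine hC.induction_on (p := fun s => ∃ F : C(K, ℝ), 0 ≤ F ∧ P F = 0 ∧ ∀ t ∈ s, 0 < F t)
      ⟨0, le_rfl, map_zero P, by simp⟩ ?_ ?_ ?_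
    · rintro s t hst ⟨F, h0, h1, h2⟩
      exact ⟨F, h0, h1, fun k hk => h2 k (hst hk)⟩
    · rintro s t ⟨F, h0, h1, h2⟩ ⟨G, g0, g1, g2⟩
      refine ⟨F + G, add_nonneg h0 g0, by simp [h1, g1], ?_⟩
      rintro k (hk | hk)
      · exact add_pos_of_pos_of_nonneg (h2 k hk) (g0 k)
      · exact add_pos_of_nonneg_of_pos (h0 k) (g2 k hk)
    · intro t ht
      obtain ⟨f, f0, f1, f2⟩ := hcov t ht
      exact ⟨{k | 0 < f k}, mem_nhdsWithin_of_mem_nhds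
        ((isOpen_lt continuous_const f.continuous).mem_nhds f2), f, f0, f1, fun k hk => hk⟩
  -- The constant is `‖g‖` divided by the minimum of `F` on `{g ≥ ε}`, or 0 if that set is empty.
  obtain ⟨c, hc, hgc⟩ : ∃ c : ℝ, 0 ≤ c ∧ ∀ t, g t ≤ ε + c * F t := by
    by_cases hne : {k | ε ≤ g k}.Nonempty
    · obtain ⟨t0, ht0, hmin⟩ := hC.exists_isMinOn hne F.continuous.continuousOn
      refine ⟨‖g‖ / F t0, div_nonneg (norm_nonneg _) (hF0 t0), fun t => ?_⟩
      by_cases ht : ε ≤ g t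
      · have h1 : F t0 ≤ F t := hmin ht
        have h2 : ‖g‖ ≤ ‖g‖ / F t0 * F t := by
          rw [div_mul_eq_mul_div, le_div_iff₀ (hF t0 ht0)]
          gcongr
        have h3 := (le_abs_self _).trans (g.norm_coe_le_norm t)
        linarith
      · have : 0 ≤ ‖g‖ / F t0 * F t :=
          mul_nonneg (div_nonneg (norm_nonneg _) (hF0 t0)) (hF0 t)
        linarith
    · refine ⟨0, le_rfl, fun t => ?_⟩
      have : ¬ ε ≤ g t := fun ht => hne ⟨t, ht⟩
      linarith
  have hle : g ≤ ε • 1 + c • F := fun t => by simpa using hgc t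
  have := hP.mono hle k
  simpa [hP.map_one, hPF] using this

theorem complexify_eq_zero_of_carrierSet (hP : IsMarkov P) {g : C(K, ℂ)}
    (h : ∀ k ∈ carrierSet P, g k = 0) : complexify P g = 0 := by
  have h1 : P (sqAbs g) = 0 :=
    hP.map_eq_zero_of_carrierSet (sqAbs_nonneg g) fun k hk => by simp [h k hk]
  ext k
  have h2 := hP.sqAbs_complexify_le g k
  rw [h1] at h2
  exact Complex.normSq_eq_zero.1 (le_antisymm h2 (Complex.normSq_nonneg _))

end IsMarkov

end Operator

end MarkovOperator

namespace MarkovOperator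

/-! ### Independent functions and dual points -/

section LinearAlgebra

/-- Finitely many linearly independent functions can be recombined into a family that is dual to
the evaluations at suitable points. -/
theorem exists_dual_points {S : Type*} {d : ℕ} {f : Fin d → S → ℂ} (hf : LinearIndependent ℂ f) :
    ∃ (s : Fin d → S) (c : Fin d → Fin d → ℂ),
      ∀ i l, ∑ j, c i j * f j (s l) = if i = l then 1 else 0 := by
  classical
  let R : S → Fin d → ℂ := fun t j => f j t
  have happly : ∀ (φ : (Fin d → ℂ) →ₗ[ℂ] ℂ) (v : Fin d → ℂ),
      φ v = ∑ j, φ (Pi.single j 1) * v j := by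
    intro φ v
    rw [φ.pi_apply_eq_sum_univ]
    refine Finset.sum_congr rfl fun j _ => ?_
    rw [smul_eq_mul, mul_comm]
    congr 2
    ext i; simp [Pi.single_apply, eq_comm]
  -- A functional vanishing on all the evaluation vectors `R t` would be a linear relation between
  -- the `f j`.
  have hspan : Submodule.span ℂ (Set.range R) = ⊤ := by
    by_contra hne
    obtain ⟨φ, hφ, hφR⟩ := Submodule.exists_le_ker_of_lt_top _ (lt_top_iff_ne_top.2 hne)
    apply hφ
    have hz : ∑ j, φ (Pi.single j 1) • f j = 0 := by
      funext t
      have h1 : φ (R t) = 0 := hφR (Submodule.subset_span ⟨t, rfl⟩)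
      rw [happly] at h1
      simpa only [Finset.sum_apply, Pi.smul_apply, smul_eq_mul, Pi.zero_apply] using h1
    have h0 := Fintype.linearIndependent_iff.1 hf _ hz
    refine LinearMap.pi_ext' fun j => LinearMap.ext_ring ?_
    simpa using h0 j
  -- Some evaluation vectors form a basis; its coordinate functionals supply the coefficients.
  obtain ⟨κ, a, ha, hsp, hli⟩ := exists_linearIndependent' ℂ R
  let b : Module.Basis κ ℂ (Fin d → ℂ) := Module.Basis.mk hli (by rw [hsp, hspan])
  have : Fintype κ := FiniteDimensional.fintypeBasisIndex b
  have hcard : Fintype.card κ = Fintype.card (Fin d) := by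
    rw [← Module.finrank_eq_card_basis b]; simp
  let e : Fin d ≃ κ := (Fintype.equivOfCardEq hcard).symm
  refine ⟨fun l => a (e l), fun i j => b.coord (e i) (Pi.single j 1), fun i l => ?_⟩
  have h1 : b.coord (e i) (R (a (e l))) = if i = l then 1 else 0 := by
    have : R (a (e l)) = b (e l) := by simp [b]
    rw [this, Module.Basis.coord_apply, Module.Basis.repr_self, Finsupp.single_apply]
    simp [eq_comm]
  rw [← h1, happly]

theorem linearIndependent_of_dual_points {S : Type*} {d : ℕ} {f : Fin d → S → ℂ} {s : Fin d → S}
    (h : ∀ i l, f i (s l) = if i = l then 1 else 0) : LinearIndependent ℂ f := by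
  rw [Fintype.linearIndependent_iff]
  intro c hc l
  have := congr_fun hc (s l)
  simpa [h] using this

end LinearAlgebra

/-! ### Monomials in peripheral eigenvectors -/

section Eigenvectors

variable {K : Type*} [TopologicalSpace K] {T P : C(K, ℝ) →ₗ[ℝ] C(K, ℝ)}

/-- Two commuting Markov operators `T` and `P` where `P` is a projection, fixes the peripheral
eigenvectors of `T`, and has no strictly `T`-subinvariant functions in its range. -/
structure IsPeripheralProjection (T P : C(K, ℝ) →ₗ[ℝ] C(K, ℝ)) : Prop where
  markov : IsMarkov P
  comm : ∀ f, T (P f) = P (T f)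
  idem : ∀ f, P (P f) = P f
  fix_eigenvector : ∀ (c : ℂ) (z : C(K, ℂ)), ‖c‖ = 1 → complexify T z = c • z → complexify P z = z
  eq_of_le : ∀ h, P h = h → h ≤ T h → T h = h

namespace IsPeripheralProjection

/-- `P|z|² - |z|²` is positive by Cauchy-Schwarz and is killed by the idempotent `P`, so it vanishes
on the carrier. -/
theorem proj_sqAbs (hP : IsPeripheralProjection T P) {z : C(K, ℂ)} (hz : complexify P z = z) {k : K}
    (hk : k ∈ carrierSet P) : P (sqAbs z) k = Complex.normSq (complexify P z k) := by
  have h1 : sqAbs z ≤ P (sqAbs z) := by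
    have := hP.markov.sqAbs_complexify_le z
    rwa [hz] at this
  have h2 := hk _ (sub_nonneg.2 h1) (by rw [map_sub, hP.idem, sub_self])
  rw [hz]
  simpa [sub_eq_zero] using h2

/-- Applying `P` to `|z|² ≤ T|z|²` makes `P|z|²` a `T`-subinvariant vector in the range of `P`,
hence `T`-fixed by `eq_of_le`. So the positive function `T|z|² - |z|²` is killed by `P`. -/
theorem apply_sqAbs (hT : IsMarkov T) (hP : IsPeripheralProjection T P) {c : ℂ} (hc : ‖c‖ = 1)
    {z : C(K, ℂ)} (hz : complexify T z = c • z) {k : K} (hk : k ∈ carrierSet P) :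
    T (sqAbs z) k = Complex.normSq (complexify T z k) := by
  have e : sqAbs (c • z) = sqAbs z := by
    ext k
    simp [Complex.normSq_eq_norm_sq, hc]
  have h1 : sqAbs z ≤ T (sqAbs z) := by
    have := hT.sqAbs_complexify_le z
    rwa [hz, e] at this
  have h2 : T (P (sqAbs z)) = P (sqAbs z) := by
    refine hP.eq_of_le _ (hP.idem _) ?_
    rw [hP.comm]
    exact hP.markov.mono h1
  have h3 := hk _ (sub_nonneg.2 h1) (by rw [map_sub, ← hP.comm, h2, sub_self])
  rw [hz, ← sqAbs_apply, e]
  simpa [sub_eq_zero] using h3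

variable [CompactSpace K]

/-- Equality in Cauchy-Schwarz lets the factors `z` and `star z` be pulled out of `P` at `k` one at
a time. -/
theorem proj_monomial (hP : IsPeripheralProjection T P) {z : C(K, ℂ)} (hz : complexify P z = z)
    {k : K} (hk : k ∈ carrierSet P) (a b : ℕ) :
    complexify P (z ^ a * star z ^ b) k = z k ^ a * star (z k) ^ b := by
  have h := hP.proj_sqAbs hz hk
  induction a with
  | zero =>
    induction b with
    | zero => simp [hP.markov.complexify_one]
    | succ b ih =>
      rw [pow_succ' (star z), mul_left_comm, hP.markov.complexify_star_mul h, ih, hz]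
      ring
  | succ a ih =>
    rw [pow_succ', mul_assoc, hP.markov.complexify_mul h, ih, hz]
    ring

theorem apply_monomial (hT : IsMarkov T) (hP : IsPeripheralProjection T P) {c : ℂ} (hc : ‖c‖ = 1)
    {z : C(K, ℂ)} (hz : complexify T z = c • z) {k : K} (hk : k ∈ carrierSet P) (a b : ℕ) :
    complexify T (z ^ a * star z ^ b) k = (c ^ a * star c ^ b) * (z k ^ a * star (z k) ^ b) := by
  have h := hP.apply_sqAbs hT hc hz hk
  induction a with
  | zero =>
    induction b with
    | zero => simp [hT.complexify_one]
    | succ b ih =>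
      rw [pow_succ' (star z), mul_left_comm, hT.complexify_star_mul h, ih, hz]
      simp
      ring
  | succ a ih =>
    rw [pow_succ', mul_assoc, hT.complexify_mul h, ih, hz]
    simp
    ring

/-- The projection of a monomial in an eigenvector `z` and its conjugate is an eigenvector. -/
theorem complexify_proj_monomial (hT : IsMarkov T) (hP : IsPeripheralProjection T P) {c : ℂ}
    (hc : ‖c‖ = 1) {z : C(K, ℂ)} (hz : complexify T z = c • z) (a b : ℕ) :
    complexify T (complexify P (z ^ a * star z ^ b)) =
      (c ^ a * star c ^ b) • complexify P (z ^ a * star z ^ b) := by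
  -- After commuting `T` past `P`, both sides are `P` of functions that agree on the carrier.
  rw [complexify_comm hP.comm, ← sub_eq_zero, ← map_smul, ← map_sub]
  refine hP.markov.complexify_eq_zero_of_carrierSet fun k hk => ?_
  have := hP.apply_monomial hT hc hz hk a b
  rw [ContinuousMap.sub_apply, this]
  simp

/-- The eigenspace of a power of a unimodular eigenvalue is at least as large as the eigenspace of
the eigenvalue. -/
theorem exists_linearIndependent_zpow (hT : IsMarkov T) (hP : IsPeripheralProjection T P) {c : ℂ}
    (hc : ‖c‖ = 1) (n : ℤ) {d : ℕ} {z : Fin d → C(K, ℂ)} (hli : LinearIndependent ℂ z)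
    (hz : ∀ i, complexify T (z i) = c • z i) :
    ∃ w : Fin d → C(K, ℂ), LinearIndependent ℂ w ∧ ∀ i, complexify T (w i) = c ^ n • w i := by
  -- Restriction to the carrier is injective on the eigenspace: an eigenvector is fixed by `P`, and
  -- `P` kills what vanishes on the carrier.
  let ρ : C(K, ℂ) →ₗ[ℂ] carrierSet P → ℂ :=
    { toFun := fun f k => f k
      map_add' := fun f g => rfl
      map_smul' := fun a f => rfl }
  have hρ : LinearIndependent ℂ (ρ ∘ z) := by
    rw [Fintype.linearIndependent_iff] at hli ⊢
    intro a ha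
    refine hli a ?_
    set u := ∑ i, a i • z i with hu
    have hTu : complexify T u = c • u := by
      simp only [hu, map_sum, map_smul, hz, Finset.smul_sum]
      exact Finset.sum_congr rfl fun i _ => smul_comm _ _ _
    rw [← hP.fix_eigenvector c u hc hTu]
    refine hP.markov.complexify_eq_zero_of_carrierSet fun k hk => ?_
    have h1 : ρ u = 0 := by
      rw [hu, map_sum, ← ha]
      exact Finset.sum_congr rfl fun i _ => map_smul _ _ _
    exact congr_fun h1 ⟨k, hk⟩
  obtain ⟨s, a, hs⟩ := exists_dual_points hρ
  let y : Fin d → C(K, ℂ) := fun i => ∑ j, a i j • z j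
  have hTy : ∀ i, complexify T (y i) = c • y i := fun i => by
    simp only [y, map_sum, map_smul, hz, Finset.smul_sum]
    exact Finset.sum_congr rfl fun i _ => smul_comm _ _ _
  have hy : ∀ i l, y i (s l) = if i = l then 1 else 0 := fun i l => by
    rw [← hs i l]
    simp [y, ρ]
  have hc0 : c ≠ 0 := fun h => by simp [h] at hc
  -- The extra `+ 1` cancels in the difference of the exponents but keeps both positive, so that
  -- monomials vanish where `y i` does, even when `n = 0`.
  have hpow : c ^ (n.toNat + 1) * star c ^ ((-n).toNat + 1) = c ^ n := by
    have h1 : star c = c⁻¹ := by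
      rw [Complex.inv_def, Complex.normSq_eq_norm_sq, hc]; simp
    rw [h1, ← zpow_natCast, ← zpow_natCast, inv_zpow, ← zpow_neg, ← zpow_add₀ hc0]
    congr 1
    push_cast
    omega
  refine ⟨fun i => complexify P (y i ^ (n.toNat + 1) * star (y i) ^ ((-n).toNat + 1)), ?_,
    fun i => ?_⟩
  · have h1 : LinearIndependent ℂ (ρ ∘ fun i =>
        complexify P (y i ^ (n.toNat + 1) * star (y i) ^ ((-n).toNat + 1))) := by
      refine linearIndependent_of_dual_points (s := s) fun i l => ?_
      change complexify P _ (s l : K) = _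
      rw [hP.proj_monomial (hP.fix_eigenvector c _ hc (hTy i)) (s l).2, hy]
      split <;> simp
    exact h1.of_comp ρ
  · rw [hP.complexify_proj_monomial hT hc (hTy i), hpow]

end IsPeripheralProjection

end Eigenvectors

end MarkovOperator

namespace MarkovOperator

/-! ### Limits along an idempotent ultrafilter -/

section IdempotentUltrafilter

open Filter Topology

attribute [local instance] Ultrafilter.add Ultrafilter.addSemigroup

theorem exists_idempotent_ultrafilter : ∃ p : Ultrafilter ℕ+, p + p = p :=
  (Hindman.exists_idempotent_ultrafilter_le_FS (fun _ => (1 : ℕ+))).imp fun _ h => h.1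

/-- The iterated limit of `F (m + k)` is the limit of `F` along `p + p = p`. Regularity supplies
closed neighbourhoods, which the inner limits cannot leave. -/
theorem tendsto_iterated_limit {p : Ultrafilter ℕ+} (hp : p + p = p) {α : Type*}
    [TopologicalSpace α] [RegularSpace α] {F G : ℕ+ → α} {L : α} (hF : Tendsto F p (𝓝 L))
    (hG : ∀ m, Tendsto (fun k => F (m + k)) p (𝓝 (G m))) : Tendsto G p (𝓝 L) := by
  rw [(closed_nhds_basis L).tendsto_right_iff]
  rintro U ⟨hU, hcl⟩
  have h1 : ∀ᶠ m in ((p + p : Ultrafilter ℕ+) : Filter ℕ+), F m ∈ U := by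
    rw [hp]; exact hF hU
  rw [Ultrafilter.eventually_add] at h1
  filter_upwards [h1] with m hm
  exact hcl.mem_of_tendsto (hG m) hm

/-- The limit `l` exists on the compact circle, and idempotence of `p` forces `l * l = l`. -/
theorem tendsto_pow_one {p : Ultrafilter ℕ+} (hp : p + p = p) {c : ℂ} (hc : ‖c‖ = 1) :
    Tendsto (fun m : ℕ+ => c ^ (m : ℕ)) p (𝓝 1) := by
  have hn : ∀ m : ℕ+, c ^ (m : ℕ) ∈ Metric.sphere (0 : ℂ) 1 := fun m => by simp [hc]
  obtain ⟨l, hl, hlim⟩ := (isCompact_sphere (0 : ℂ) 1).ultrafilter_le_nhds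
    (p.map fun m : ℕ+ => c ^ (m : ℕ))
    (le_principal_iff.2 (mem_map.2 (Eventually.of_forall (f := (p : Filter ℕ+)) hn)))
  have hlim : Tendsto (fun m : ℕ+ => c ^ (m : ℕ)) p (𝓝 l) := hlim
  have h1 : Tendsto (fun m : ℕ+ => c ^ (m : ℕ) * l) p (𝓝 l) := by
    refine tendsto_iterated_limit hp hlim fun m => ?_
    simpa [pow_add] using hlim.const_mul (c ^ (m : ℕ))
  have h2 := tendsto_nhds_unique h1 (hlim.mul_const l)
  have hl0 : l ≠ 0 := fun h => by simp [h] at hl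
  have : l = 1 := by
    rw [eq_comm] at h2
    exact mul_right_cancel₀ hl0 (by rw [h2, one_mul])
  rwa [this] at hlim

end IdempotentUltrafilter

/-! ### The peripheral projection as a limit of powers -/

section Projection

open Filter Topology

attribute [local instance] Ultrafilter.add Ultrafilter.addSemigroup

variable {K : Type*} [TopologicalSpace K] {T : C(K, ℝ) →ₗ[ℝ] C(K, ℝ)}

theorem IsMarkov.pow (hT : IsMarkov T) (m : ℕ) : IsMarkov (T ^ m) := by
  induction m with
  | zero => exact ⟨fun f hf => hf, rfl⟩
  | succ m ih =>
    refine ⟨fun f hf => ?_, ?_⟩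
    · rw [pow_succ']; exact hT.nonneg _ (ih.nonneg f hf)
    · rw [pow_succ', Module.End.mul_apply, ih.map_one, hT.map_one]

theorem IsMarkov.abs_le (hT : IsMarkov T) {f : C(K, ℝ)} {c : ℝ} (h : |f| ≤ c • 1) :
    |T f| ≤ c • 1 := by
  have e : T (c • 1) = c • 1 := by rw [map_smul, hT.map_one]
  refine abs_le'.2 ⟨?_, ?_⟩
  · rw [← e]; exact hT.mono ((le_abs_self f).trans h)
  · rw [← e, ← map_neg]; exact hT.mono ((neg_le_abs f).trans h)

theorem complexify_pow_parts {c : ℂ} {z : C(K, ℂ)} (hz : complexify T z = c • z) (m : ℕ) :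
    (T ^ m) (rePart z) = (c ^ m).re • rePart z - (c ^ m).im • imPart z ∧
    (T ^ m) (imPart z) = (c ^ m).re • imPart z + (c ^ m).im • rePart z := by
  have h1 : T (rePart z) = c.re • rePart z - c.im • imPart z := by
    rw [← rePart_complexify, hz, rePart_smul]
  have h2 : T (imPart z) = c.re • imPart z + c.im • rePart z := by
    rw [← imPart_complexify, hz, imPart_smul]
  induction m with
  | zero => simp
  | succ m ih =>
    rw [pow_succ', Module.End.mul_apply, Module.End.mul_apply, ih.1, ih.2]
    simp only [map_sub, map_add, map_smul, h1, h2, pow_succ', Complex.mul_re, Complex.mul_im]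
    constructor <;> module

/-- If `C(K, ℝ)` carries a weak topology, given by functionals `ℓ y`, in which order intervals are
compact and the Markov operator `T` is continuous, then the limit of `T ^ m` along an idempotent
ultrafilter is a peripheral projection for `T`. -/
theorem exists_isPeripheralProjection [CompactSpace K] (hT : IsMarkov T) {Y : Type*}
    (ℓ : Y → C(K, ℝ) →ₗ[ℝ] ℂ) (C : Set Y)
    (hord : ∀ f, 0 ≤ f ↔ ∀ y ∈ C, 0 ≤ ℓ y f)
    (hcpt : ∀ (p : Ultrafilter ℕ+) (s : ℕ+ → C(K, ℝ)) (c : ℝ), (∀ m, |s m| ≤ c • 1) →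
      ∃ g, ∀ y, Tendsto (fun m => ℓ y (s m)) p (𝓝 (ℓ y g)))
    (S : Y → Y) (hS : ∀ y f, ℓ y (T f) = ℓ (S y) f) :
    ∃ P, IsPeripheralProjection T P := by
  obtain ⟨p, hp⟩ := exists_idempotent_ultrafilter
  have hsep : ∀ f g, (∀ y, ℓ y f = ℓ y g) → f = g := by
    intro f g h
    refine le_antisymm ?_ ?_ <;>
    · rw [← sub_nonneg, hord]
      intro y _
      rw [map_sub, h, sub_self]
  have hbdd : ∀ f : C(K, ℝ), |f| ≤ ‖f‖ • 1 := fun f k => by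
    simpa using f.norm_coe_le_norm k
  have hex : ∀ f, ∃ g, ∀ y, Tendsto (fun m : ℕ+ => ℓ y ((T ^ (m : ℕ)) f)) p (𝓝 (ℓ y g)) :=
    fun f => hcpt p _ ‖f‖ fun m => (hT.pow m).abs_le (hbdd f)
  choose Q hQ using hex
  have huniq : ∀ f g, (∀ y, Tendsto (fun m : ℕ+ => ℓ y ((T ^ (m : ℕ)) f)) p (𝓝 (ℓ y g))) →
      Q f = g := fun f g h => hsep _ _ fun y => tendsto_nhds_unique (hQ f y) (h y)
  let P : C(K, ℝ) →ₗ[ℝ] C(K, ℝ) :=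
    { toFun := Q
      map_add' := fun f g => huniq _ _ fun y => by
        simpa only [map_add] using (hQ f y).add (hQ g y)
      map_smul' := fun c f => huniq _ _ fun y => by
        simpa only [map_smul, RingHom.id_apply] using (hQ f y).const_smul c }
  have hPQ : ∀ f, P f = Q f := fun _ => rfl
  -- Moving powers of `T` onto the test vector is what lets them pass through the weak limit.
  have hSm : ∀ (m : ℕ) y f, ℓ y ((T ^ m) f) = ℓ (S^[m] y) f := by
    intro m
    induction m with
    | zero => simp
    | succ m ih =>
      intro y f
      rw [pow_succ', Module.End.mul_apply, hS, ih, Function.iterate_succ_apply]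
  refine ⟨P, ⟨fun f hf => ?_, ?_⟩, fun f => ?_, fun f => ?_, fun c z hc hz => ?_, fun h hh hle => ?_⟩
  · rw [hord]
    intro y hy
    exact ge_of_tendsto' (hQ f y) fun m => (hord _).1 ((hT.pow m).nonneg f hf) y hy
  · refine huniq _ _ fun y => ?_
    simp only [(hT.pow _).map_one]
    exact tendsto_const_nhds
  · symm
    refine huniq _ _ fun y => ?_
    rw [hS]
    refine (hQ f (S y)).congr fun m => ?_
    rw [← hS, ← Module.End.mul_apply, ← Module.End.mul_apply, ← pow_succ, ← pow_succ']
  -- `P (P f)` is an iterated limit of `T ^ (m + k) f`, so idempotence of `p` gives idempotence of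
  -- `P`.
  · refine huniq _ _ fun y => ?_
    refine tendsto_iterated_limit hp (hQ f y) fun m => ?_
    rw [hPQ, hSm]
    refine (hQ f _).congr fun k => ?_
    rw [← hSm, PNat.add_coe, pow_add, Module.End.mul_apply]
  · have hone := tendsto_pow_one hp hc
    have hre : Tendsto (fun m : ℕ+ => (c ^ (m : ℕ)).re) p (𝓝 1) := by
      simpa [Function.comp_def] using (Complex.continuous_re.tendsto _).comp hone
    have him : Tendsto (fun m : ℕ+ => (c ^ (m : ℕ)).im) p (𝓝 0) := by
      simpa [Function.comp_def] using (Complex.continuous_im.tendsto _).comp hone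
    refine ext_parts ?_ ?_
    · rw [rePart_complexify]
      refine huniq _ _ fun y => ?_
      simp only [(complexify_pow_parts hz _).1, map_sub, map_smul]
      simpa using (hre.smul_const (ℓ y (rePart z))).sub (him.smul_const (ℓ y (imPart z)))
    · rw [imPart_complexify]
      refine huniq _ _ fun y => ?_
      simp only [(complexify_pow_parts hz _).2, map_add, map_smul]
      simpa using (hre.smul_const (ℓ y (imPart z))).add (him.smul_const (ℓ y (rePart z)))
  -- From `h ≤ T h` follows `T h ≤ T ^ m h` for all `m ≥ 1`; the limit is `T h ≤ P h = h`. Indexing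
  -- by `ℕ+` excludes `m = 0`.
  · refine le_antisymm ?_ hle
    have hmono : ∀ m : ℕ, T h ≤ (T ^ (m + 1)) h := by
      intro m
      induction m with
      | zero => simp
      | succ m ih =>
        rw [pow_succ']
        exact hT.mono (hle.trans ih)
    rw [← sub_nonneg, hord]
    intro y hy
    have h1 := (hQ h y).sub_const (ℓ y (T h))
    rw [← hPQ, hh, ← map_sub] at h1
    refine ge_of_tendsto' h1 fun m => ?_
    rw [← map_sub]
    obtain ⟨k, hk⟩ := Nat.exists_eq_succ_of_ne_zero m.ne_zero
    rw [hk]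
    exact (hord _).1 (sub_nonneg.2 (hmono k)) y hy

end Projection

end MarkovOperator

/-! ### Kakutani's theorem: characters as minimal sup-functionals -/

namespace OrderUnit

variable {V : Type*} [AddCommGroup V] [Lattice V] [Module ℝ V]

/-- Monotone sublinear functionals that preserve finite suprema and are dominated by the gauge of
the order unit `e`. -/
structure IsSupFunctional (e : V) (q : V → ℝ) : Prop where
  add_le : ∀ a b, q (a + b) ≤ q a + q b
  smul_le : ∀ (c : ℝ) a, 0 < c → q (c • a) ≤ c * q a
  mono : ∀ a b, a ≤ b → q a ≤ q b
  sup_le : ∀ a b, q (a ⊔ b) ≤ max (q a) (q b)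
  le_of_le_smul : ∀ a (t : ℝ), a ≤ t • e → q a ≤ t

/-- The part of the sublinear functional `q` carried by the points where `b` is maximal. -/
noncomputable def tilt (q : V → ℝ) (b : V) (a : V) : ℝ :=
  ⨅ s : NNReal, (q (a + (s : ℝ) • b) - s * q b)

namespace IsSupFunctional

variable {e : V} {q : V → ℝ}

theorem map_zero (hq : IsSupFunctional e q) : q 0 = 0 := by
  have h1 := hq.add_le 0 0
  have h2 := hq.le_of_le_smul 0 0 (by simp)
  rw [add_zero] at h1
  linarith

theorem neg_le (hq : IsSupFunctional e q) (a : V) : -q (-a) ≤ q a := by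
  have h1 := hq.add_le a (-a)
  rw [add_neg_cancel, hq.map_zero] at h1
  linarith

theorem smul_eq (hq : IsSupFunctional e q) {c : ℝ} (hc : 0 ≤ c) (a : V) : q (c • a) = c * q a := by
  rcases hc.eq_or_lt with rfl | hc
  · simp [hq.map_zero]
  · refine le_antisymm (hq.smul_le c a hc) ?_
    have := hq.smul_le c⁻¹ (c • a) (inv_pos.2 hc)
    rwa [inv_smul_smul₀ hc.ne', inv_mul_eq_div, le_div_iff₀ hc, mul_comm] at this

theorem bddBelow_tilt (hq : IsSupFunctional e q) (b a : V) :
    BddBelow (Set.range fun s : NNReal => q (a + (s : ℝ) • b) - s * q b) := by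
  refine ⟨-q (-a), ?_⟩
  rintro _ ⟨s, rfl⟩
  have h1 := hq.add_le (a + (s : ℝ) • b) (-a)
  rw [add_neg_cancel_comm, hq.smul_eq s.coe_nonneg] at h1
  change _ ≤ q (a + (s : ℝ) • b) - s * q b
  linarith

theorem tilt_le_apply (hq : IsSupFunctional e q) (b a : V) (s : NNReal) :
    tilt q b a ≤ q (a + (s : ℝ) • b) - s * q b := ciInf_le (hq.bddBelow_tilt b a) s

theorem tilt_le (hq : IsSupFunctional e q) (b a : V) : tilt q b a ≤ q a := by
  simpa using hq.tilt_le_apply b a 0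

theorem tilt_neg_le (hq : IsSupFunctional e q) (b : V) : tilt q b (-b) ≤ -q b := by
  simpa [hq.map_zero] using hq.tilt_le_apply b (-b) 1

/-- Monotonicity in `s` makes the infimum a limit, so two near-optimal parameters can be replaced by
their maximum. -/
theorem antitone_tilt (hq : IsSupFunctional e q) (b a : V) :
    Antitone fun s : NNReal => q (a + (s : ℝ) • b) - s * q b := by
  intro s t hst
  have h1 : (0 : ℝ) ≤ t - s := sub_nonneg.2 (NNReal.coe_le_coe.2 hst)
  have h2 := hq.add_le (a + (s : ℝ) • b) (((t : ℝ) - s) • b)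
  have e1 : a + (s : ℝ) • b + ((t : ℝ) - s) • b = a + (t : ℝ) • b := by module
  rw [e1, hq.smul_eq h1] at h2
  change q (a + (t : ℝ) • b) - t * q b ≤ q (a + (s : ℝ) • b) - s * q b
  linarith

protected theorem tilt [IsOrderedAddMonoid V] (hq : IsSupFunctional e q) (b : V) :
    IsSupFunctional e (tilt q b) where
  add_le a a' := by
    refine le_ciInf_add_ciInf fun s t => ?_
    refine (hq.tilt_le_apply b _ (s + t)).trans ?_
    have h := hq.add_le (a + (s : ℝ) • b) (a' + (t : ℝ) • b)
    have e1 : a + (s : ℝ) • b + (a' + (t : ℝ) • b) = a + a' + ((s + t : NNReal) : ℝ) • b := by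
      push_cast; module
    rw [e1] at h
    have e2 : ((s + t : NNReal) : ℝ) = s + t := by simp
    rw [e2] at h ⊢
    linarith
  smul_le c a hc := by
    lift c to NNReal using hc.le
    rw [← div_le_iff₀' hc]
    refine le_ciInf fun s => ?_
    rw [div_le_iff₀' hc]
    refine (hq.tilt_le_apply b _ (c * s)).trans ?_
    have e1 : (c : ℝ) • a + ((c * s : NNReal) : ℝ) • b = (c : ℝ) • (a + (s : ℝ) • b) := by
      rw [NNReal.coe_mul, smul_add, smul_smul]
    rw [e1, hq.smul_eq hc.le, NNReal.coe_mul]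
    exact le_of_eq (by ring)
  mono a a' h := by
    refine ciInf_mono (hq.bddBelow_tilt b a) fun s => ?_
    exact sub_le_sub_right (hq.mono _ _ (add_le_add_left h _)) _
  sup_le a a' := by
    by_contra! hlt
    obtain ⟨h1, h2⟩ := max_lt_iff.1 hlt
    obtain ⟨s, hs⟩ := exists_lt_of_ciInf_lt h1
    obtain ⟨t, ht⟩ := exists_lt_of_ciInf_lt h2
    have hs' := (hq.antitone_tilt b a (le_max_left s t)).trans_lt hs
    have ht' := (hq.antitone_tilt b a' (le_max_right s t)).trans_lt ht
    -- At the common parameter `max s t`, translation distributes over the supremum and `sup_le` for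
    -- `q` applies.
    have h3 := hq.tilt_le_apply b (a ⊔ a') (max s t)
    have h4 := hq.sup_le (a + ((max s t : NNReal) : ℝ) • b) (a' + ((max s t : NNReal) : ℝ) • b)
    rw [← sup_add] at h4
    rcases le_max_iff.1 h4 with h | h
    · simp only at hs'; linarith
    · simp only at ht'; linarith
  le_of_le_smul a t h := (hq.tilt_le b a).trans (hq.le_of_le_smul a t h)

/-- The pointwise infimum of a chain of sup-functionals is a sup-functional. -/
theorem iInf_chain {ι : Type*} [Nonempty ι] {f : ι → V → ℝ}
    (hf : ∀ i, IsSupFunctional e (f i)) (hdir : ∀ i j, f i ≤ f j ∨ f j ≤ f i)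
    (hbdd : ∀ a, BddBelow (Set.range fun i => f i a)) :
    IsSupFunctional e fun a => ⨅ i, f i a where
  add_le a b := by
    refine le_ciInf_add_ciInf fun i j => ?_
    rcases hdir i j with h | h
    · exact (ciInf_le (hbdd _) i).trans (((hf i).add_le a b).trans (by gcongr; exact h b))
    · exact (ciInf_le (hbdd _) j).trans (((hf j).add_le a b).trans (by gcongr; exact h a))
  smul_le c a hc := by
    rw [← div_le_iff₀' hc]
    refine le_ciInf fun i => ?_
    rw [div_le_iff₀' hc]
    exact (ciInf_le (hbdd _) i).trans ((hf i).smul_le c a hc)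
  mono a b h := ciInf_mono (hbdd a) fun i => (hf i).mono a b h
  sup_le a b := by
    by_contra! hlt
    obtain ⟨h1, h2⟩ := max_lt_iff.1 hlt
    obtain ⟨i, hi⟩ := exists_lt_of_ciInf_lt h1
    obtain ⟨j, hj⟩ := exists_lt_of_ciInf_lt h2
    rcases hdir i j with h | h
    · have := (ciInf_le (hbdd _) i).trans ((hf i).sup_le a b)
      rcases le_max_iff.1 this with h3 | h3
      · exact absurd hi (not_lt.2 h3)
      · exact absurd ((h b).trans_lt hj) (not_lt.2 h3)
    · have := (ciInf_le (hbdd _) j).trans ((hf j).sup_le a b)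
      rcases le_max_iff.1 this with h3 | h3
      · exact absurd ((h a).trans_lt hi) (not_lt.2 h3)
      · exact absurd hj (not_lt.2 h3)
  le_of_le_smul a t h :=
    (ciInf_le (hbdd a) (Classical.arbitrary ι)).trans ((hf _).le_of_le_smul a t h)

/-- Zorn's lemma for the reversed order; the order unit bounds each chain below pointwise, via `-q
(-a) ≤ q a`. -/
theorem exists_minimal (hunit : ∀ a : V, ∃ c : ℝ, a ≤ c • e) (hq : IsSupFunctional e q) :
    ∃ m ≤ q, Minimal (IsSupFunctional e) m := by
  refine zorn_le_nonempty₀ (α := (V → ℝ)ᵒᵈ) {f | IsSupFunctional e f} ?_ q hq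
  intro C hC hchain y hy
  have : Nonempty C := ⟨⟨y, hy⟩⟩
  let g : C → V → ℝ := fun i => OrderDual.ofDual i.1
  have hg : ∀ i, IsSupFunctional e (g i) := fun i => hC i.2
  have hbdd : ∀ a, BddBelow (Set.range fun i : C => g i a) := by
    intro a
    obtain ⟨t, ht⟩ := hunit (-a)
    refine ⟨-t, ?_⟩
    rintro _ ⟨f, rfl⟩
    have h1 := (hg f).le_of_le_smul _ _ ht
    have h2 := (hg f).neg_le a
    change -t ≤ g f a
    linarith
  refine ⟨OrderDual.toDual fun a => ⨅ i : C, g i a, iInf_chain hg ?_ hbdd,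
    fun z hz a => ciInf_le (hbdd a) ⟨z, hz⟩⟩
  intro i j
  exact (hchain.total i.2 j.2).symm

/-- Tilting cannot lower a minimal `q`, so `q (-b) ≤ tilt q b (-b) ≤ -q b`; subadditivity gives the
converse. Oddness upgrades the sublinear `q` to a linear functional, hence a lattice homomorphism.
-/
theorem neg_of_minimal [IsOrderedAddMonoid V] (hq : Minimal (IsSupFunctional e) q) (b : V) :
    q (-b) = -q b := by
  have h1 := hq.le_of_le (hq.prop.tilt b) (hq.prop.tilt_le b) (-b)
  have h2 := hq.prop.tilt_neg_le b
  have h3 := hq.prop.neg_le b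
  linarith

theorem add_of_minimal [IsOrderedAddMonoid V] (hq : Minimal (IsSupFunctional e) q) (a b : V) :
    q (a + b) = q a + q b := by
  refine le_antisymm (hq.prop.add_le a b) ?_
  have h1 := hq.prop.add_le (a + b) (-b)
  rw [add_neg_cancel_right, neg_of_minimal hq] at h1
  linarith

theorem smul_of_minimal [IsOrderedAddMonoid V] (hq : Minimal (IsSupFunctional e) q) (c : ℝ)
    (a : V) : q (c • a) = c * q a := by
  rcases le_total 0 c with hc | hc
  · exact hq.prop.smul_eq hc a
  · have := hq.prop.smul_eq (neg_nonneg.2 hc) a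
    rw [neg_smul, neg_of_minimal hq] at this
    linarith

theorem sup_of_minimal (hq : Minimal (IsSupFunctional e) q) (a b : V) :
    q (a ⊔ b) = max (q a) (q b) :=
  le_antisymm (hq.prop.sup_le a b)
    (max_le (hq.prop.mono _ _ le_sup_left) (hq.prop.mono _ _ le_sup_right))

theorem unit_of_minimal [IsOrderedAddMonoid V] (hq : Minimal (IsSupFunctional e) q) :
    q e = 1 := by
  have h1 := hq.prop.le_of_le_smul e 1 (by simp)
  have h2 := hq.prop.le_of_le_smul (-e) (-1) (by simp)
  rw [neg_of_minimal hq] at h2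
  linarith

end IsSupFunctional

/-- The lattice homomorphisms `V → ℝ` normalised at `e`. -/
def characters (e : V) : Set (V → ℝ) :=
  {φ | (∀ a b, φ (a + b) = φ a + φ b) ∧ (∀ (c : ℝ) a, φ (c • a) = c * φ a) ∧
    (∀ a b, φ (a ⊔ b) = max (φ a) (φ b)) ∧ φ e = 1}

section Gauge

variable [IsOrderedAddMonoid V] [IsOrderedModule ℝ V] {e : V}

/-- The gauge of the order unit `e`. -/
noncomputable def gauge (e a : V) : ℝ := sInf {t : ℝ | a ≤ t • e}

theorem bddBelow_gauge (he : 0 < e) (hunit : ∀ a : V, ∃ c : ℝ, a ≤ c • e) (a : V) :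
    BddBelow {t : ℝ | a ≤ t • e} := by
  obtain ⟨s, hs⟩ := hunit (-a)
  refine ⟨-s, fun t ht => ?_⟩
  by_contra! hlt
  have h1 : 0 ≤ (t + s) • e := by
    have := add_le_add ht hs
    rwa [add_neg_cancel, ← add_smul] at this
  have h2 : 0 ≤ (-(t + s)) • e := smul_nonneg (by linarith) he.le
  rw [neg_smul, neg_nonneg] at h2
  have h3 := le_antisymm h2 h1
  rcases smul_eq_zero.1 h3 with h | h
  · linarith
  · exact he.ne' h

theorem isSupFunctional_gauge (he : 0 < e) (hunit : ∀ a : V, ∃ c : ℝ, a ≤ c • e) :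
    IsSupFunctional e (gauge e) := by
  have hb := bddBelow_gauge he hunit
  have hmem : ∀ a (t : ℝ), gauge e a < t → a ≤ t • e := by
    intro a t ht
    obtain ⟨s, hs, hst⟩ := exists_lt_of_csInf_lt (hunit a) ht
    exact le_trans hs (smul_le_smul_of_nonneg_right hst.le he.le)
  have hle : ∀ a (t : ℝ), a ≤ t • e → gauge e a ≤ t := fun a t h => csInf_le (hb a) h
  refine ⟨fun a b => ?_, fun c a hc => ?_, fun a b h => ?_, fun a b => ?_, hle⟩
  · refine le_of_forall_pos_le_add fun ε hε => hle _ _ ?_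
    have h1 := add_le_add (hmem a (gauge e a + ε / 2) (by linarith))
      (hmem b (gauge e b + ε / 2) (by linarith))
    rw [← add_smul] at h1
    convert h1 using 2
    ring
  · refine le_of_forall_gt_imp_ge_of_dense fun t ht => hle _ _ ?_
    have h1 := hmem a (t / c) (by rwa [lt_div_iff₀' hc])
    have h2 := smul_le_smul_of_nonneg_left h1 hc.le
    rwa [smul_smul, mul_div_cancel₀ _ hc.ne'] at h2
  · exact le_of_forall_gt_imp_ge_of_dense fun t ht => hle _ _ (h.trans (hmem b t ht))
  · refine le_of_forall_gt_imp_ge_of_dense fun t ht => hle _ _ ?_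
    obtain ⟨h1, h2⟩ := max_lt_iff.1 ht
    exact sup_le (hmem a t h1) (hmem b t h2)

/-- If `a ≤ ε • e` fails, then `gauge e a ≥ ε`. Tilting the gauge at `a` freezes this value: every
minimal functional below the tilt is a character `m` with `m a ≥ ε`. -/
theorem le_zero_of_characters (he : 0 < e) (hunit : ∀ a : V, ∃ c : ℝ, a ≤ c • e)
    (harch : ∀ a : V, (∀ ε : ℝ, 0 < ε → a ≤ ε • e) → a ≤ 0) {a : V}
    (h : ∀ φ ∈ characters e, φ a ≤ 0) : a ≤ 0 := by
  refine harch a fun ε hε => ?_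
  by_contra hcon
  have hg := isSupFunctional_gauge he hunit
  have h1 : ε ≤ gauge e a := by
    by_contra! hlt
    obtain ⟨s, hs, hst⟩ := exists_lt_of_csInf_lt (hunit a) hlt
    exact hcon (le_trans hs (smul_le_smul_of_nonneg_right hst.le he.le))
  obtain ⟨m, hm, hmin⟩ := (hg.tilt a).exists_minimal hunit
  have h2 := (hm (-a)).trans (hg.tilt_neg_le a)
  rw [IsSupFunctional.neg_of_minimal hmin] at h2
  have h3 := h m ⟨IsSupFunctional.add_of_minimal hmin, IsSupFunctional.smul_of_minimal hmin,
    IsSupFunctional.sup_of_minimal hmin, IsSupFunctional.unit_of_minimal hmin⟩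
  linarith

end Gauge

/-! ### The space of characters and the representation on it -/

section Characters

variable {e : V}

theorem characters_mono {φ : V → ℝ} (hφ : φ ∈ characters e) {a b : V} (h : a ≤ b) : φ a ≤ φ b := by
  have := hφ.2.2.1 a b
  rw [sup_eq_right.2 h] at this
  rw [this]
  exact le_max_left _ _

/-- The characters form a closed subset of a product of compact intervals, whose endpoints come from
`a ≤ c a • e` and `-a ≤ c (-a) • e`. -/
theorem compactSpace_characters (hunit : ∀ a : V, ∃ c : ℝ, a ≤ c • e) :
    CompactSpace (characters e) := by
  rw [← isCompact_iff_compactSpace]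
  choose c hc using hunit
  have hle : ∀ φ ∈ characters e, ∀ a, φ a ≤ c a := fun φ hφ a => by
    have := characters_mono hφ (hc a)
    rwa [hφ.2.1, hφ.2.2.2, mul_one] at this
  refine (isCompact_univ_pi fun a => isCompact_Icc (a := -c (-a)) (b := c a)).of_isClosed_subset
    ?_ ?_
  · simp only [characters, Set.ofPred_and, Set.ofPred_forall]
    refine .inter ?_ (.inter ?_ (.inter ?_ ?_))
    · exact isClosed_iInter fun a => isClosed_iInter fun b => isClosed_eq (by fun_prop) (by fun_prop)
    · exact isClosed_iInter fun a => isClosed_iInter fun b => isClosed_eq (by fun_prop) (by fun_prop)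
    · exact isClosed_iInter fun a => isClosed_iInter fun b => isClosed_eq (by fun_prop) (by fun_prop)
    · exact isClosed_eq (by fun_prop) (by fun_prop)
  · intro φ hφ a _
    refine ⟨?_, hle φ hφ a⟩
    have h1 := hle φ hφ (-a)
    have h2 := hφ.2.1 (-1) a
    rw [neg_one_smul] at h2
    linarith

/-- Evaluation of the elements of `V` at the characters. -/
def evalCharacters (e : V) : V →ₗ[ℝ] C(characters e, ℝ) where
  toFun a := ⟨fun φ => φ.1 a, (continuous_apply a).comp continuous_subtype_val⟩
  map_add' a b := by ext φ; exact φ.2.1 a b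
  map_smul' c a := by ext φ; exact φ.2.2.1 c a

@[simp] theorem evalCharacters_apply (a : V) (φ : characters e) :
    evalCharacters e a φ = φ.1 a := rfl

theorem evalCharacters_unit : evalCharacters e e = 1 := by
  ext φ; exact φ.2.2.2.2

theorem evalCharacters_sup (a b : V) :
    evalCharacters e (a ⊔ b) = evalCharacters e a ⊔ evalCharacters e b := by
  ext φ; exact φ.2.2.2.1 a b

variable [IsOrderedAddMonoid V]

theorem evalCharacters_inf (a b : V) :
    evalCharacters e (a ⊓ b) = evalCharacters e a ⊓ evalCharacters e b := by
  have h : a ⊓ b = -(-a ⊔ -b) := by rw [neg_sup, neg_neg, neg_neg]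
  rw [h, map_neg, evalCharacters_sup, map_neg, map_neg, neg_sup, neg_neg, neg_neg]

variable [IsOrderedModule ℝ V]

theorem evalCharacters_nonneg_iff (he : 0 < e) (hunit : ∀ a : V, ∃ c : ℝ, a ≤ c • e)
    (harch : ∀ a : V, (∀ ε : ℝ, 0 < ε → a ≤ ε • e) → a ≤ 0) {a : V} :
    0 ≤ evalCharacters e a ↔ 0 ≤ a := by
  constructor
  · intro h
    rw [← neg_nonpos]
    refine le_zero_of_characters he hunit harch fun φ hφ => ?_
    have h1 := h ⟨φ, hφ⟩
    have h2 := hφ.2.1 (-1) a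
    rw [neg_one_smul] at h2
    change 0 ≤ φ a at h1
    linarith
  · intro h φ
    have h1 := characters_mono φ.2 h
    have h2 := φ.2.2.1 0 0
    rw [zero_smul, zero_mul] at h2
    rwa [h2] at h1

/-- **Kakutani's representation theorem**: a uniformly complete Archimedean vector lattice with
order unit `e` is isomorphic to the continuous functions on its space of characters. -/
theorem exists_equiv_continuousMap (he : 0 < e) (hunit : ∀ a : V, ∃ c : ℝ, a ≤ c • e)
    (harch : ∀ a : V, (∀ ε : ℝ, 0 < ε → a ≤ ε • e) → a ≤ 0)
    (hcomplete : ∀ s : ℕ → V,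
      (∀ N n m, N ≤ n → N ≤ m → |s n - s m| ≤ (2 / ((N : ℝ) + 1)) • e) →
      ∃ a, ∀ N, |s N - a| ≤ (2 / ((N : ℝ) + 1)) • e) :
    ∃ Φ : V ≃ₗ[ℝ] C(characters e, ℝ), Φ e = 1 ∧ ∀ a, 0 ≤ Φ a ↔ 0 ≤ a := by
  have := compactSpace_characters hunit
  have hnn : ∀ {a}, 0 ≤ evalCharacters e a ↔ 0 ≤ a := evalCharacters_nonneg_iff he hunit harch
  have hle : ∀ {a b}, evalCharacters e a ≤ evalCharacters e b ↔ a ≤ b := fun {a b} => by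
    rw [← sub_nonneg, ← map_sub, hnn, sub_nonneg]
  have habs : ∀ a, evalCharacters e |a| = |evalCharacters e a| := fun a => by
    rw [abs, evalCharacters_sup, map_neg, abs]
  have hinj : Function.Injective (evalCharacters e) := fun a b h =>
    le_antisymm (hle.1 h.le) (hle.1 h.ge)
  -- The lattice form of Stone-Weierstrass, which needs two-point interpolation.
  have hdense : closure (Set.range (evalCharacters e)) = ⊤ := by
    refine ContinuousMap.sublattice_closure_eq_top _ ⟨_, 0, rfl⟩ ?_ ?_ ?_
    · rintro _ ⟨a, rfl⟩ _ ⟨b, rfl⟩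
      exact ⟨a ⊓ b, evalCharacters_inf a b⟩
    · rintro _ ⟨a, rfl⟩ _ ⟨b, rfl⟩
      exact ⟨a ⊔ b, evalCharacters_sup a b⟩
    · intro v φ ψ
      by_cases h : φ = ψ
      · subst h
        exact ⟨_, ⟨v φ • e, rfl⟩, by rw [map_smul, evalCharacters_unit]; simp⟩
      · have : ∃ a, φ.1 a ≠ ψ.1 a := by
          by_contra! hcon
          exact h (Subtype.ext (funext hcon))
        obtain ⟨a, ha⟩ := this
        have ha' : φ.1 a - ψ.1 a ≠ 0 := sub_ne_zero.2 ha
        -- The affine expression in `a` with value `v φ` at `φ` and `v ψ` at `ψ`.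
        refine ⟨_, ⟨v ψ • e + ((v φ - v ψ) / (φ.1 a - ψ.1 a)) • (a - ψ.1 a • e), rfl⟩, ?_⟩
        simp only [map_add, map_smul, map_sub, evalCharacters_unit]
        constructor
        · simp; field_simp; ring
        · simp
  have hsurj : Function.Surjective (evalCharacters e) := by
    intro f
    have happrox : ∀ n : ℕ, ∃ a : V, ‖evalCharacters e a - f‖ < 1 / ((n : ℝ) + 1) := by
      intro n
      have hf : f ∈ closure (Set.range (evalCharacters e)) := by rw [hdense]; trivial
      obtain ⟨_, ⟨a, rfl⟩, ha⟩ := Metric.mem_closure_iff.1 hf (1 / ((n : ℝ) + 1)) (by positivity)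
      exact ⟨a, by rwa [dist_eq_norm, norm_sub_rev] at ha⟩
    choose s hs using happrox
    have hs' : ∀ N n, N ≤ n → ∀ φ, |evalCharacters e (s n) φ - f φ| ≤ 1 / ((N : ℝ) + 1) := by
      intro N n hn φ
      refine ((ContinuousMap.norm_coe_le_norm (evalCharacters e (s n) - f) φ).trans
        (hs n).le).trans ?_
      gcongr
    -- Two approximations of `f` within `1 / (N + 1)` account for the constant 2 in `hcomplete`.
    obtain ⟨a, ha⟩ := hcomplete s fun N n m hn hm => by
      rw [← hle, habs, map_sub, map_smul, evalCharacters_unit]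
      intro φ
      have h1 := abs_le.1 (hs' N n hn φ)
      have h2 := abs_le.1 (hs' N m hm φ)
      have e1 : 2 / ((N : ℝ) + 1) = 1 / ((N : ℝ) + 1) + 1 / ((N : ℝ) + 1) := by ring
      change |evalCharacters e (s n) φ - evalCharacters e (s m) φ| ≤ 2 / ((N : ℝ) + 1) * 1
      rw [abs_le, e1]
      constructor <;> linarith
    refine ⟨a, ContinuousMap.ext fun φ => ?_⟩
    have h3 : ∀ N : ℕ, |evalCharacters e a φ - f φ| ≤ 3 * (1 / ((N : ℝ) + 1)) := by
      intro N
      have h1 := ha N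
      rw [← hle, habs, map_sub, map_smul, evalCharacters_unit] at h1
      have h2 : |evalCharacters e (s N) φ - evalCharacters e a φ| ≤ 2 / ((N : ℝ) + 1) * 1 := h1 φ
      have h4 := abs_le.1 (hs' N N le_rfl φ)
      have h5 := abs_le.1 h2
      have e1 : 2 / ((N : ℝ) + 1) = 2 * (1 / ((N : ℝ) + 1)) := by ring
      rw [e1] at h5
      rw [abs_le]
      constructor <;> linarith
    have h6 : |evalCharacters e a φ - f φ| ≤ 0 := by
      have h7 : Filter.Tendsto (fun N : ℕ => 3 * (1 / ((N : ℝ) + 1))) Filter.atTop (nhds 0) := by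
        simpa using (tendsto_one_div_add_atTop_nhds_zero_nat (𝕜 := ℝ)).const_mul 3
      exact ge_of_tendsto' h7 h3
    exact sub_eq_zero.1 (abs_nonpos_iff.1 h6)
  exact ⟨LinearEquiv.ofBijective _ ⟨hinj, hsurj⟩, evalCharacters_unit, fun a => hnn⟩

end Characters

end OrderUnit

/-! ### Principal ideals of a Banach lattice -/

namespace OrderUnit

universe v

variable {X : Type v} [NormedAddCommGroup X] [Lattice X] [IsOrderedAddMonoid X]
  [NormedSpace ℝ X] [IsOrderedModule ℝ X]

/-- The real principal ideal generated by `u`. -/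
def orderIdeal (u : X) : Submodule ℝ X where
  carrier := {a | ∃ c : ℝ, 0 ≤ c ∧ |a| ≤ c • u}
  add_mem' := by
    rintro a b ⟨c, hc, ha⟩ ⟨d, hd, hb⟩
    refine ⟨c + d, add_nonneg hc hd, (abs_add_le a b).trans ?_⟩
    rw [add_smul]
    exact add_le_add ha hb
  zero_mem' := ⟨0, le_rfl, by simp⟩
  smul_mem' := by
    rintro t a ⟨c, hc, ha⟩
    refine ⟨|t| * c, mul_nonneg (abs_nonneg t) hc, ?_⟩
    have h : |t| • |a| ≤ (|t| * c) • u := by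
      rw [mul_smul]
      exact smul_le_smul_of_nonneg_left ha (abs_nonneg t)
    refine (abs_le'.2 ⟨Complexification.smul_le_abs_smul_abs t a, ?_⟩).trans h
    have := Complexification.smul_le_abs_smul_abs (-t) a
    rwa [neg_smul, abs_neg] at this

theorem mem_orderIdeal_of_abs_le {u a b : X} (hb : b ∈ orderIdeal u) (h : |a| ≤ |b|) :
    a ∈ orderIdeal u :=
  let ⟨c, hc, hbc⟩ := hb
  ⟨c, hc, h.trans hbc⟩

theorem abs_mem_orderIdeal {u a : X} (ha : a ∈ orderIdeal u) : |a| ∈ orderIdeal u :=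
  mem_orderIdeal_of_abs_le ha (by rw [abs_abs])

theorem sup_mem_orderIdeal {u a b : X} (ha : a ∈ orderIdeal u) (hb : b ∈ orderIdeal u) :
    a ⊔ b ∈ orderIdeal u := by
  refine mem_orderIdeal_of_abs_le
    ((orderIdeal u).add_mem (abs_mem_orderIdeal ha) (abs_mem_orderIdeal hb)) ?_
  rw [abs_of_nonneg (add_nonneg (abs_nonneg a) (abs_nonneg b))]
  refine abs_le'.2 ⟨sup_le ((le_abs_self a).trans (le_add_of_nonneg_right (abs_nonneg b)))
    ((le_abs_self b).trans (le_add_of_nonneg_left (abs_nonneg a))), ?_⟩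
  exact ((neg_le_neg le_sup_left).trans (neg_le_abs a)).trans
    (le_add_of_nonneg_right (abs_nonneg b))

theorem inf_mem_orderIdeal {u a b : X} (ha : a ∈ orderIdeal u) (hb : b ∈ orderIdeal u) :
    a ⊓ b ∈ orderIdeal u := by
  have h : a ⊓ b = -(-a ⊔ -b) := by rw [neg_sup, neg_neg, neg_neg]
  rw [h]
  exact neg_mem (sup_mem_orderIdeal (neg_mem ha) (neg_mem hb))

instance (u : X) : Lattice (orderIdeal u) :=
  Subtype.lattice (P := (· ∈ orderIdeal u)) (fun _ _ => sup_mem_orderIdeal)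
    (fun _ _ => inf_mem_orderIdeal)

instance (u : X) : IsOrderedAddMonoid (orderIdeal u) where
  add_le_add_left _ _ h c := add_le_add_left (α := X) h c

instance (u : X) : IsOrderedModule ℝ (orderIdeal u) where
  smul_le_smul_of_nonneg_left _ hc _ _ h := smul_le_smul_of_nonneg_left (β := X) h hc
  smul_le_smul_of_nonneg_right _ ha _ _ h := smul_le_smul_of_nonneg_right (β := X) h ha

/-- In a Banach lattice, the principal ideal generated by `u > 0` is isomorphic to some
`C(K, ℝ)`, with `u` corresponding to the constant function `1`. -/
theorem exists_continuousMap_embedding [HasSolidNorm X] [CompleteSpace X] {u : X} (hu : 0 < u) :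
    ∃ (K : Type v) (_ : TopologicalSpace K) (_ : CompactSpace K) (j : C(K, ℝ) →ₗ[ℝ] X),
      j 1 = u ∧ (∀ f, 0 ≤ j f ↔ 0 ≤ f) ∧ LinearMap.range j = orderIdeal u := by
  let e : orderIdeal u := ⟨u, 1, zero_le_one, by rw [abs_of_nonneg hu.le, one_smul]⟩
  have he : 0 < e := hu
  have hunit : ∀ a : orderIdeal u, ∃ c : ℝ, a ≤ c • e := by
    rintro ⟨a, c, hc, ha⟩
    exact ⟨c, (le_abs_self a).trans ha⟩
  -- The Archimedean property holds because `u / (n + 1)` tends to 0 in norm and the order is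
  -- closed.
  have harch : ∀ a : orderIdeal u, (∀ ε : ℝ, 0 < ε → a ≤ ε • e) → a ≤ 0 := by
    intro a ha
    have h1 : Filter.Tendsto (fun n : ℕ => (1 / ((n : ℝ) + 1)) • u) Filter.atTop (nhds 0) := by
      simpa using (tendsto_one_div_add_atTop_nhds_zero_nat (𝕜 := ℝ)).smul_const u
    exact ge_of_tendsto' (b := (a : X)) h1 fun n => ha _ (by positivity)
  have hcomplete : ∀ s : ℕ → orderIdeal u,
      (∀ N n m, N ≤ n → N ≤ m → |s n - s m| ≤ (2 / ((N : ℝ) + 1)) • e) →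
      ∃ a, ∀ N, |s N - a| ≤ (2 / ((N : ℝ) + 1)) • e := by
    intro s hs
    have hs' : ∀ N n m : ℕ, N ≤ n → N ≤ m → |(s n : X) - s m| ≤ (2 / ((N : ℝ) + 1)) • u := hs
    have hcau : CauchySeq fun n => (s n : X) := by
      refine cauchySeq_of_le_tendsto_0 (fun N : ℕ => 2 / ((N : ℝ) + 1) * ‖u‖)
        (fun n m N hn hm => ?_) ?_
      · rw [dist_eq_norm]
        refine (norm_le_norm_of_abs_le_abs ((hs' N n m hn hm).trans (le_abs_self _))).trans_eq ?_
        rw [norm_smul, Real.norm_of_nonneg (by positivity)]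
      · have := (tendsto_one_div_add_atTop_nhds_zero_nat (𝕜 := ℝ)).const_mul (2 * ‖u‖)
        rw [mul_zero] at this
        refine this.congr fun n => ?_
        ring
    obtain ⟨a, ha⟩ := cauchySeq_tendsto_of_complete hcau
    have hlim : ∀ N : ℕ, |(s N : X) - a| ≤ (2 / ((N : ℝ) + 1)) • u := by
      intro N
      have h1 := ha.const_sub (s N : X)
      have h2 : ∀ᶠ n in Filter.atTop, |(s N : X) - s n| ≤ (2 / ((N : ℝ) + 1)) • u :=
        Filter.eventually_atTop.2 ⟨N, fun n hn => hs' N N n le_rfl hn⟩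
      refine abs_le'.2 ⟨le_of_tendsto h1 (h2.mono fun n hn => (le_abs_self _).trans hn),
        le_of_tendsto h1.neg (h2.mono fun n hn => (neg_le_abs _).trans hn)⟩
    -- The norm limit stays in the ideal, since `s 0 - a` is bounded by a multiple of `u`.
    have hmem : a ∈ orderIdeal u := by
      have h1 : (s 0 : X) - a ∈ orderIdeal u := ⟨_, by positivity, hlim 0⟩
      have h2 := sub_mem (s 0).2 h1
      rwa [sub_sub_cancel] at h2
    exact ⟨⟨a, hmem⟩, hlim⟩
  obtain ⟨Φ, hΦ1, hΦ⟩ := exists_equiv_continuousMap he hunit harch hcomplete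
  refine ⟨characters e, inferInstance, compactSpace_characters hunit,
    (orderIdeal u).subtype ∘ₗ Φ.symm.toLinearMap, ?_, fun f => ?_, ?_⟩
  · rw [← hΦ1]; simp [e]
  · have := hΦ (Φ.symm f)
    rw [LinearEquiv.apply_symm_apply] at this
    exact this.symm
  · rw [LinearMap.range_comp, LinearEquiv.range, Submodule.map_top, Submodule.range_subtype]

end OrderUnit

/-! ### Real and imaginary parts of ideals and positive operators -/

namespace Complexification

section

variable {X : Type*} [NormedAddCommGroup X] [NormedSpace ℝ X]

@[simp] theorem real_smul_re (c : ℝ) (z : Complexification X) : (c • z).re = c • z.re := by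
  rw [← Complex.coe_smul, smul_re, Complex.ofReal_re, Complex.ofReal_im, zero_smul, sub_zero]

@[simp] theorem real_smul_im (c : ℝ) (z : Complexification X) : (c • z).im = c • z.im := by
  rw [← Complex.coe_smul, smul_im, Complex.ofReal_re, Complex.ofReal_im, zero_smul, add_zero]

/-- The inclusion of the real part. -/
def ofReal : X →ₗ[ℝ] Complexification X where
  toFun a := ⟨a, 0⟩
  map_add' a b := by ext <;> simp
  map_smul' c a := by
    ext <;> simp

@[simp] theorem ofReal_re (a : X) : (ofReal a).re = a := rfl
@[simp] theorem ofReal_im (a : X) : (ofReal a).im = 0 := rfl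

theorem ofReal_nonneg [Lattice X] {a : X} : 0 ≤ ofReal a ↔ 0 ≤ a := by
  simp [le_def]

theorem ofReal_add_I_smul (a b : X) :
    (⟨a, b⟩ : Complexification X) = ofReal a + Complex.I • ofReal b := by
  ext <;> simp

variable {K : Type*} [TopologicalSpace K]

/-- The complex linear extension of a linear map `C(K, ℝ) → X`. -/
noncomputable def extend (j : C(K, ℝ) →ₗ[ℝ] X) : C(K, ℂ) →ₗ[ℂ] Complexification X where
  toFun f := ⟨j (MarkovOperator.rePart f), j (MarkovOperator.imPart f)⟩
  map_add' f g := by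
    ext <;> simp [MarkovOperator.rePart_add, MarkovOperator.imPart_add]
  map_smul' c f := by
    ext <;> simp [MarkovOperator.rePart_smul, MarkovOperator.imPart_smul]

theorem extend_apply (j : C(K, ℝ) →ₗ[ℝ] X) (f : C(K, ℂ)) :
    extend j f = ⟨j (MarkovOperator.rePart f), j (MarkovOperator.imPart f)⟩ := rfl

theorem extend_injective {j : C(K, ℝ) →ₗ[ℝ] X} (hj : Function.Injective j) :
    Function.Injective (extend j) := fun _ _ h =>
  MarkovOperator.ext_parts (hj congr(($h).re)) (hj congr(($h).im))

end

section

variable {X : Type*} [NormedAddCommGroup X] [Lattice X] [IsOrderedAddMonoid X] [HasSolidNorm X]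
  [NormedSpace ℝ X] [IsOrderedModule ℝ X] [CompleteSpace X]

theorem modulus_ofReal {u : X} (hu : 0 ≤ u) : modulus (ofReal u) = u := by
  refine le_antisymm ?_ ((le_abs_self u).trans (abs_re_le_modulus (ofReal u)))
  simpa [abs_of_nonneg hu] using modulus_le_abs_add_abs (ofReal u)

/-- The modulus dominates `|z.re|` and `|z.im|` and is dominated by their sum. -/
theorem mem_principalIdeal_ofReal {u : X} (hu : 0 ≤ u) {z : Complexification X} :
    z ∈ principalIdeal (ofReal u) ↔
      z.re ∈ OrderUnit.orderIdeal u ∧ z.im ∈ OrderUnit.orderIdeal u := by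
  change (∃ c : ℝ, 0 ≤ c ∧ modulus z ≤ c • modulus (ofReal u)) ↔ _
  rw [modulus_ofReal hu]
  constructor
  · rintro ⟨c, hc, h⟩
    exact ⟨⟨c, hc, (abs_re_le_modulus z).trans h⟩, ⟨c, hc, (abs_im_le_modulus z).trans h⟩⟩
  · rintro ⟨⟨c, hc, h⟩, ⟨d, hd, h'⟩⟩
    refine ⟨c + d, add_nonneg hc hd, (modulus_le_abs_add_abs z).trans ?_⟩
    rw [add_smul]
    exact add_le_add h h'

variable {T : Complexification X →L[ℂ] Complexification X}

/-- A real vector is the difference of the positive vectors `|a|` and `|a| - a`. -/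
theorem IsPositiveOperator.ofReal_im (hT : IsPositiveOperator T) (a : X) :
    (T (ofReal a)).im = 0 := by
  have h : ∀ b : X, 0 ≤ b → (T (ofReal b)).im = 0 := fun b hb =>
    (hT _ (ofReal_nonneg.2 hb)).2.symm
  have e : ofReal a = ofReal |a| - ofReal (|a| - a) := by rw [← map_sub, sub_sub_cancel]
  rw [e, map_sub, sub_im, h _ (abs_nonneg a), h _ (sub_nonneg.2 (le_abs_self a)), sub_zero]

/-- The restriction of an operator on `X + iX` to the real part. -/
noncomputable def realRestrict (T : Complexification X →L[ℂ] Complexification X) : X →ₗ[ℝ] X where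
  toFun a := (T (ofReal a)).re
  map_add' a b := by simp
  map_smul' c a := by
    rw [map_smul, ← Complex.coe_smul, map_smul, Complex.coe_smul]
    simp

theorem IsPositiveOperator.apply_ofReal (hT : IsPositiveOperator T) (a : X) :
    T (ofReal a) = ofReal (realRestrict T a) :=
  Complexification.ext rfl (hT.ofReal_im a)

theorem IsPositiveOperator.realRestrict_nonneg (hT : IsPositiveOperator T) {a : X} (ha : 0 ≤ a) :
    0 ≤ realRestrict T a := by
  have := hT _ (ofReal_nonneg.2 ha)
  rwa [hT.apply_ofReal, ofReal_nonneg] at this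

theorem IsPositiveOperator.apply_mk (hT : IsPositiveOperator T) (a b : X) :
    T ⟨a, b⟩ = ⟨realRestrict T a, realRestrict T b⟩ := by
  rw [ofReal_add_I_smul, map_add, map_smul, hT.apply_ofReal, hT.apply_ofReal,
    ← ofReal_add_I_smul]

end

end Complexification

/-! ### Weak-* compactness of order intervals -/

namespace PredualBanachLattice

open Complexification Filter Topology

variable {X : Type*} [NormedAddCommGroup X] [Lattice X] [IsOrderedAddMonoid X] [HasSolidNorm X]
  [NormedSpace ℝ X] [IsOrderedModule ℝ X] [CompleteSpace X]
  {Y : Type*} [NormedAddCommGroup Y] [Lattice Y] [IsOrderedAddMonoid Y] [HasSolidNorm Y]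
  [NormedSpace ℝ Y] [IsOrderedModule ℝ Y] [CompleteSpace Y]

/-- Bounded families in a dual Banach lattice converge weak-* along ultrafilters. -/
theorem exists_tendsto (J : PredualBanachLattice X Y) {ι : Type*} (p : Ultrafilter ι)
    (s : ι → Complexification X) (R : ℝ) (hs : ∀ i, ‖s i‖ ≤ R) :
    ∃ w, ∀ y, Tendsto (fun i => J.toDual (s i) y) p (𝓝 (J.toDual w y)) := by
  have hcpt := WeakDual.isCompact_closedBall (0 : StrongDual ℂ (Complexification Y)) R
  obtain ⟨L, -, hL⟩ := hcpt.ultrafilter_le_nhds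
    (p.map fun i => StrongDual.toWeakDual (J.toDual (s i)))
    (le_principal_iff.2 (mem_map.2 (Eventually.of_forall (f := (p : Filter ι)) fun i => by
      simpa using hs i)))
  refine ⟨J.toDual.symm (WeakDual.toStrongDual L), fun y => ?_⟩
  rw [LinearIsometryEquiv.apply_symm_apply]
  have hL : Tendsto (fun i => StrongDual.toWeakDual (J.toDual (s i))) p (𝓝 L) := hL
  exact ((WeakDual.eval_continuous y).tendsto L).comp hL

/-- Positivity is preserved under weak-* limits. -/
theorem nonneg_of_tendsto (J : PredualBanachLattice X Y) {ι : Type*} {p : Filter ι} [p.NeBot]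
    {s : ι → Complexification X} {w : Complexification X} (hs : ∀ i, 0 ≤ s i)
    (h : ∀ y, Tendsto (fun i => J.toDual (s i) y) p (𝓝 (J.toDual w y))) : 0 ≤ w :=
  (J.nonneg_iff w).2 fun y hy => ge_of_tendsto' (h y) fun i => (J.nonneg_iff _).1 (hs i) y hy

/-- Order intervals in the real part of a dual Banach lattice are weak-* compact. -/
theorem exists_tendsto_ofReal (J : PredualBanachLattice X Y) {ι : Type*} (p : Ultrafilter ι)
    {u : X} (s : ι → X) (hs : ∀ i, |s i| ≤ u) :
    ∃ a, |a| ≤ u ∧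
      ∀ y, Tendsto (fun i => J.toDual (ofReal (s i)) y) p (𝓝 (J.toDual (ofReal a) y)) := by
  obtain ⟨w, hw⟩ := J.exists_tendsto p (fun i => ofReal (s i)) ‖u‖ fun i => by
    rw [norm_def]
    refine norm_le_norm_of_abs_le_abs ?_
    rw [abs_of_nonneg (modulus_nonneg _)]
    refine (modulus_le_abs_add_abs _).trans ?_
    simpa using (hs i).trans (le_abs_self u)
  have h1 : 0 ≤ ofReal u - w := by
    refine J.nonneg_of_tendsto (p := p) (s := fun i => ofReal (u - s i)) (fun i => ?_) fun y => ?_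
    · exact ofReal_nonneg.2 (sub_nonneg.2 ((le_abs_self _).trans (hs i)))
    · simp only [map_sub, sub_apply]
      exact (hw y).const_sub _
  have h2 : 0 ≤ ofReal u + w := by
    refine J.nonneg_of_tendsto (p := p) (s := fun i => ofReal (u + s i)) (fun i => ?_) fun y => ?_
    · exact ofReal_nonneg.2 (neg_le_iff_add_nonneg'.1 ((neg_le.1 ((neg_le_abs _).trans (hs i)))))
    · simp only [map_add, add_apply]
      exact (hw y).const_add _
  -- Positivity of `u + w` includes that it is real, so the weak-* limit is real as well.
  have him : w.im = 0 := by simpa using h2.2.symm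
  have hwr : w = ofReal w.re := Complexification.ext rfl him
  refine ⟨w.re, abs_le'.2 ⟨?_, ?_⟩, fun y => by rw [← hwr]; exact hw y⟩
  · simpa using h1.1
  · have h3 : 0 ≤ u + w.re := by simpa using h2.1
    exact neg_le_iff_add_nonneg.2 h3

end PredualBanachLattice

/-! ### Transfer to `C(K)` and back -/

namespace Complexification

open MarkovOperator OrderUnit

universe v

variable {X : Type v} [NormedAddCommGroup X] [Lattice X] [IsOrderedAddMonoid X] [HasSolidNorm X]
  [NormedSpace ℝ X] [IsOrderedModule ℝ X] [CompleteSpace X]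
  {Y : Type*} [NormedAddCommGroup Y] [Lattice Y] [IsOrderedAddMonoid Y] [HasSolidNorm Y]
  [NormedSpace ℝ Y] [IsOrderedModule ℝ Y] [CompleteSpace Y]

/-- A positive operator with fixed vector `u > 0` restricts to the ideal generated by `u`, which is
a space of continuous functions, and if the operator has a pre-adjoint then the restriction has a
peripheral projection. -/
theorem exists_markov_model (J : PredualBanachLattice X Y)
    {T : Complexification X →L[ℂ] Complexification X} (hT : IsPositiveOperator T)
    {S : Complexification Y →L[ℂ] Complexification Y} (hS : J.IsPreadjoint S T) {r : ℝ}
    (hr : 0 < r) {u : X} (hu : 0 < u) (hTu : T (ofReal u) = (r : ℂ) • ofReal u) :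
    ∃ (K : Type v) (_ : TopologicalSpace K) (_ : CompactSpace K) (Ψ : C(K, ℂ) →ₗ[ℂ]
      Complexification X) (A P : C(K, ℝ) →ₗ[ℝ] C(K, ℝ)), Function.Injective Ψ ∧
      LinearMap.range Ψ = principalIdeal (ofReal u) ∧ IsMarkov A ∧
      IsPeripheralProjection A P ∧ ∀ f, T (Ψ f) = (r : ℂ) • Ψ (complexify A f) := by
  obtain ⟨K, _, _, j, hj1, hj0, hjr⟩ := exists_continuousMap_embedding hu
  have hjinj : Function.Injective j := by
    intro f g h
    refine le_antisymm ?_ ?_ <;> rw [← sub_nonneg, ← hj0, map_sub, h, sub_self]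
  have hRu : realRestrict T u = r • u := by
    have := hT.apply_ofReal u
    rw [hTu] at this
    simpa using congr(($this).re).symm
  have hRabs : ∀ a c, |a| ≤ c • u → |realRestrict T a| ≤ (c * r) • u := by
    intro a c h
    have e : realRestrict T (c • u) = (c * r) • u := by rw [map_smul, hRu, smul_smul]
    rw [← e]
    refine abs_le'.2 ⟨?_, ?_⟩
    · rw [← sub_nonneg, ← map_sub]
      exact hT.realRestrict_nonneg (sub_nonneg.2 ((le_abs_self a).trans h))
    · rw [← sub_nonneg, ← map_neg, ← map_sub]
      exact hT.realRestrict_nonneg (sub_nonneg.2 ((neg_le_abs a).trans h))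
  have hmaps : ∀ f, ((r⁻¹ • realRestrict T) ∘ₗ j) f ∈ LinearMap.range j := by
    intro f
    have hf : j f ∈ orderIdeal u := by rw [← hjr]; exact ⟨f, rfl⟩
    obtain ⟨c, hc, h⟩ := hf
    rw [hjr]
    exact (orderIdeal u).smul_mem r⁻¹ ⟨c * r, by positivity, hRabs _ _ h⟩
  -- `r⁻¹T` preserves the ideal because it fixes `u`; `A` is its conjugate under `j`.
  let A : C(K, ℝ) →ₗ[ℝ] C(K, ℝ) := (LinearEquiv.ofInjective j hjinj).symm.toLinearMap ∘ₗ
    ((r⁻¹ • realRestrict T) ∘ₗ j).codRestrict (LinearMap.range j) hmaps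
  have hA : ∀ f, j (A f) = r⁻¹ • realRestrict T (j f) := fun f => by
    have := LinearEquiv.apply_symm_apply (LinearEquiv.ofInjective j hjinj)
      (((r⁻¹ • realRestrict T) ∘ₗ j).codRestrict (LinearMap.range j) hmaps f)
    exact congr_arg Subtype.val this
  have hA' : ∀ f, realRestrict T (j f) = r • j (A f) := fun f => by
    rw [hA, smul_inv_smul₀ hr.ne']
  have hAM : IsMarkov A := by
    refine ⟨fun f hf => ?_, hjinj ?_⟩
    · rw [← hj0, hA]
      exact smul_nonneg (inv_nonneg.2 hr.le) (hT.realRestrict_nonneg ((hj0 f).2 hf))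
    · rw [hA, hj1, hRu, inv_smul_smul₀ hr.ne']
  let ℓ : Complexification Y → C(K, ℝ) →ₗ[ℝ] ℂ := fun y =>
    { toFun := fun f => J.toDual (ofReal (j f)) y
      map_add' := fun f g => by simp
      map_smul' := fun c f => by
        rw [map_smul, map_smul, ← Complex.coe_smul, map_smul]
        simp }
  have hℓ : ∀ y f, ℓ y f = J.toDual (ofReal (j f)) y := fun _ _ => rfl
  obtain ⟨P, hP⟩ := exists_isPeripheralProjection hAM ℓ {y | 0 ≤ y}
    (fun f => by
      rw [← hj0, ← ofReal_nonneg, J.nonneg_iff]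
      rfl)
    -- The weak-* limit obeys the same bound `c • u`, so it stays in the ideal and comes from a
    -- continuous function.
    (fun p s c hs => by
      obtain ⟨a, ha, hlim⟩ := J.exists_tendsto_ofReal p (u := c • u) (fun m => j (s m))
        fun m => by
          have h1 := (hj0 _).2 (sub_nonneg.2 ((le_abs_self _).trans (hs m)))
          have h2 := (hj0 _).2 (sub_nonneg.2 ((neg_le_abs _).trans (hs m)))
          rw [map_sub, map_smul, hj1, sub_nonneg] at h1 h2
          rw [map_neg] at h2
          exact abs_le'.2 ⟨h1, h2⟩
      have hmem : a ∈ LinearMap.range j := by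
        rw [hjr]
        -- Membership needs a nonnegative constant, while the sign of `c` is not given.
        refine ⟨|c|, abs_nonneg c, ha.trans ?_⟩
        exact smul_le_smul_of_nonneg_right (le_abs_self c) hu.le
      obtain ⟨g, rfl⟩ := hmem
      exact ⟨g, hlim⟩)
    (fun y => (r⁻¹ : ℂ) • S y) (fun y f => by
      have h1 := hS (ofReal (j f)) y
      rw [hT.apply_ofReal, hA', map_smul, ← Complex.coe_smul, map_smul] at h1
      rw [hℓ, hℓ, map_smul, ← h1]
      simp [hr.ne'])
  refine ⟨K, inferInstance, inferInstance, extend j, A, P, extend_injective hjinj, ?_, hAM, hP,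
    fun f => ?_⟩
  · ext z
    rw [mem_principalIdeal_ofReal hu.le, ← hjr]
    constructor
    · rintro ⟨f, rfl⟩
      exact ⟨⟨_, rfl⟩, ⟨_, rfl⟩⟩
    · rintro ⟨⟨f, hf⟩, ⟨g, hg⟩⟩
      refine ⟨⟨fun k => f k + g k * Complex.I, by fun_prop⟩, Complexification.ext ?_ ?_⟩
      · rw [← hf]
        change j _ = j f
        congr 1
        ext; simp
      · rw [← hg]
        change j _ = j g
        congr 1
        ext; simp
  · rw [extend_apply, hT.apply_mk, hA', hA', extend_apply]
    ext <;> simp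

/-- Linearly independent families in `E_x ∩ ker (r e^{iθ} - T)` give rise to linearly independent
families of the same size in `E_x ∩ ker (r e^{inθ} - T)`. -/
theorem exists_linearIndependent_eigenvectors (J : PredualBanachLattice X Y)
    {T : Complexification X →L[ℂ] Complexification X} (hT : IsPositiveOperator T)
    {S : Complexification Y →L[ℂ] Complexification Y} (hS : J.IsPreadjoint S T) {r : ℝ}
    (hr : 0 < r) {u : X} (hu : 0 < u) (hTu : T (ofReal u) = (r : ℂ) • ofReal u) {c : ℂ}
    (hc : ‖c‖ = 1) (n : ℤ) {d : ℕ} {z : Fin d → Complexification X}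
    (hli : LinearIndependent ℂ z) (hz : ∀ i, z i ∈ principalIdeal (ofReal u))
    (hTz : ∀ i, T (z i) = (r * c) • z i) :
    ∃ w : Fin d → Complexification X, LinearIndependent ℂ w ∧
      (∀ i, w i ∈ principalIdeal (ofReal u)) ∧ ∀ i, T (w i) = (r * c ^ n) • w i := by
  obtain ⟨K, _, _, Ψ, A, P, hΨ, hrange, hA, hP, hTΨ⟩ := exists_markov_model J hT hS hr hu hTu
  rw [← hrange] at hz ⊢
  choose f hf using hz
  obtain rfl : Ψ ∘ f = z := funext hf
  have hr0 : (r : ℂ) ≠ 0 := by exact_mod_cast hr.ne'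
  have hAf : ∀ i, complexify A (f i) = c • f i := fun i => by
    have h1 := hTz i
    rw [Function.comp_apply, hTΨ, mul_smul] at h1
    have h2 := smul_right_injective _ hr0 h1
    rw [← map_smul] at h2
    exact hΨ h2
  obtain ⟨w, hw, hAw⟩ := hP.exists_linearIndependent_zpow hA hc n (hli.of_comp Ψ) hAf
  refine ⟨Ψ ∘ w, hw.map' Ψ (LinearMap.ker_eq_bot.2 hΨ), fun i => ⟨w i, rfl⟩, fun i => ?_⟩
  rw [Function.comp_apply, hTΨ, hAw, map_smul, mul_smul]

end Complexification



/-! ### Dimensions and eigenvectors in the original lattice -/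

theorem mainTheorem6
    {X : Type*} [NormedAddCommGroup X] [Lattice X] [IsOrderedAddMonoid X] [HasSolidNorm X]
    [NormedSpace ℝ X] [IsOrderedModule ℝ X] [CompleteSpace X]
    {Y : Type*} [NormedAddCommGroup Y] [Lattice Y] [IsOrderedAddMonoid Y] [HasSolidNorm Y]
    [NormedSpace ℝ Y] [IsOrderedModule ℝ Y] [CompleteSpace Y]
    (J : PredualBanachLattice X Y)
    (T : Complexification X →L[ℂ] Complexification X)
    (hT : Complexification.IsPositiveOperator T)
    (hpre : ∃ S : Complexification Y →L[ℂ] Complexification Y, J.IsPreadjoint S T)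
    (r θ : ℝ) (hr : 0 < r)
    (x : Complexification X) (hx : 0 < x) (hTx : T x = (r : ℂ) • x) :
    (∀ n : ℤ,
      Cardinal.toENat (Module.rank ℂ
        (Complexification.principalIdeal x ⊓
          Module.End.eigenspace (T : Complexification X →ₗ[ℂ] Complexification X)
            (r * Complex.exp (θ * Complex.I)) : Submodule ℂ (Complexification X))) ≤
      Cardinal.toENat (Module.rank ℂ
        (Complexification.principalIdeal x ⊓
          Module.End.eigenspace (T : Complexification X →ₗ[ℂ] Complexification X)
            (r * Complex.exp (n * θ * Complex.I)) : Submodule ℂ (Complexification X)))) ∧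
    ((∃ z ∈ Complexification.principalIdeal x, z ≠ 0 ∧
        T z = ((r : ℂ) * Complex.exp (θ * Complex.I)) • z) →
      ∀ n : ℤ, ∃ w ∈ Complexification.principalIdeal x, w ≠ 0 ∧
        T w = ((r : ℂ) * Complex.exp (n * θ * Complex.I)) • w) := by
  obtain ⟨S, hS⟩ := hpre
  have him : x.im = 0 := hx.le.2.symm
  obtain ⟨u, rfl⟩ : ∃ u, x = Complexification.ofReal u :=
    ⟨x.re, Complexification.ext rfl him⟩
  have hu : 0 < u := by
    refine lt_of_le_of_ne (Complexification.ofReal_nonneg.1 hx.le) ?_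
    rintro rfl
    rw [map_zero] at hx
    exact lt_irrefl _ hx
  have hc : ‖Complex.exp (θ * Complex.I)‖ = 1 := Complex.norm_exp_ofReal_mul_I θ
  have hpow : ∀ n : ℤ, Complex.exp (n * θ * Complex.I) = Complex.exp (θ * Complex.I) ^ n :=
    fun n => by rw [← Complex.exp_int_mul, mul_assoc]
  constructor
  · intro n
    -- Dimensions in `ℕ∞` are compared through the natural numbers below them, so finite independent
    -- families suffice even in infinite dimension.
    refine ENat.forall_natCast_le_iff_le.1 fun d hd => ?_
    rw [Cardinal.natCast_le_toENat, Module.le_rank_iff] at hd ⊢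
    obtain ⟨v, hv⟩ := hd
    obtain ⟨w, hw, hwx, hwT⟩ := Complexification.exists_linearIndependent_eigenvectors J hT hS hr hu
      hTx hc n (hv.map' _ (Submodule.ker_subtype _)) (fun i => (v i).2.1)
      (fun i => Module.End.mem_eigenspace_iff.1 (v i).2.2)
    rw [← hpow] at hwT
    exact ⟨fun i => ⟨w i, hwx i, Module.End.mem_eigenspace_iff.2 (hwT i)⟩,
      LinearIndependent.of_comp (Submodule.subtype _) hw⟩
  · rintro ⟨z, hzx, hz0, hzT⟩ n
    -- A nonzero eigenvector is an independent family of size 1.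
    obtain ⟨w, hw, hwx, hwT⟩ := Complexification.exists_linearIndependent_eigenvectors J hT hS hr hu
      hTx hc n (d := 1) (z := fun _ => z) (linearIndependent_unique_iff.2 hz0)
      (fun _ => hzx) (fun _ => hzT)
    rw [← hpow] at hwT
    exact ⟨w 0, hwx 0, hw.ne_zero 0, hwT 0⟩
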